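/- Let $[n]=\{1,\dots,n\}$ and, for integers $1\le r\le k\le n$, let $A(n,k,r)$ be the graph whose vertices are the ordered $k$-tuples of distinct elements of $[n]$, two tuples $[s_1,\dots,s_k]$ and $[t_1,\dots,t_k]$ being adjacent if and only if $|\{i : s_i\neq t_i\}|=r$. For $g\in S_n$ let $P(g)$ be the permutation $[s_1,\dots,s_k]\mapsto[g(s_1),\dots,g(s_k)]$ of the vertex set, and for $q\in S_k$ let $Q(q)$ be the permutation $[s_1,\dots,s_k]\mapsto[s_{q^{-1}(1)},\dots,s_{q^{-1}(k)}]$. When $k=n$, let $h$ be the permutation of the vertex set given by $[s_1,\dots,s_n]\mapsto[x_1,\dots,x_n]$, where $x_j=i$ if $s_i=j$; that is, $h$ sends a tuple, read as a permutation of $[n]$, to its inverse. Let $n>2$. Then the full automorphism group of $A(n,k,r)$, as a group of permutations of the vertex set, is as follows. 1. If $1\le r=k<n$, then $\mathrm{Aut}(A(n,k,k))=P(S_n)\times Q(S_k)$ (internal direct product). 2. If $r=k=n$, then $\mathrm{Aut}(A(n,n,n))=[P(S_n)\times Q(S_n)]\rtimes\langle h\rangle$ (internal semidirect product), where $h$ has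 order $2$. 3. If $r=2$ and $k=n$, then $\mathrm{Aut}(A(n,n,2))=[P(S_n)\times Q(S_n)]\rtimes\langle h\rangle$ (internal semidirect product), where $h$ has order $2$. -/

import Mathlib

/-- The set `[n]^(k)` of ordered `k`-tuples of distinct elements of an `n`-element set. -/
abbrev Tuples (n k : ℕ) : Type := Fin k ↪ Fin n

/-- The `(n,k,r)`-arrangement graph (for `1 ≤ r`): two `k`-tuples of distinct symbols are adjacent
iff they differ in exactly `r` coordinates. The clause `s ≠ t` is automatic when `1 ≤ r`; it only
makes the graph loopless for the junk value `r = 0`. -/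
def arrangementGraph (n k r : ℕ) : SimpleGraph (Tuples n k) where
  Adj s t := s ≠ t ∧ (Finset.univ.filter fun i : Fin k => s i ≠ t i).card = r
  symm := ⟨fun s t h => ⟨h.1.symm, by simpa only [ne_comm] using h.2⟩⟩
  loopless := ⟨fun _ h => h.1 rfl⟩

/-- `P g` permutes the symbols: `[s_1, …, s_k] ↦ [g s_1, …, g s_k]`. -/
def symbolPerm (n k : ℕ) : Equiv.Perm (Fin n) →* Equiv.Perm (Tuples n k) where
  toFun g :=
    { toFun := fun s => s.trans g.toEmbedding
      invFun := fun s => s.trans g⁻¹.toEmbedding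
      left_inv := fun s => by ext i; simp
      right_inv := fun s => by ext i; simp }
  map_one' := by ext s i; simp
  map_mul' g g' := by ext s i; simp

/-- `Q h` permutes the coordinates: the `i`-th entry of the image of `s` is `s_{h⁻¹ i}`. -/
def coordPerm (n k : ℕ) : Equiv.Perm (Fin k) →* Equiv.Perm (Tuples n k) where
  toFun h :=
    { toFun := fun s => h⁻¹.toEmbedding.trans s
      invFun := fun s => h.toEmbedding.trans s
      left_inv := fun s => by ext i; simp
      right_inv := fun s => by ext i; simp }
  map_one' := by ext s i; simp
  map_mul' h h' := by ext s i; simp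

/-- The map sending an `n`-tuple `s` of distinct elements of `[n]`, read as the permutation
`i ↦ s_i`, to the inverse permutation: the `j`-th entry of the image is the `i` with `s_i = j`. -/
noncomputable def inversionPerm (n : ℕ) : Equiv.Perm (Tuples n n) where
  toFun s := s.equivOfFiniteSelfEmbedding.symm.toEmbedding
  invFun s := s.equivOfFiniteSelfEmbedding.symm.toEmbedding
  left_inv s := by
    have h : ∀ e : Fin n ≃ Fin n, e.toEmbedding.equivOfFiniteSelfEmbedding = e := fun e => by
      ext i; rfl
    simp only [h, Equiv.symm_symm]
    ext i; rfl
  right_inv s := by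
    have h : ∀ e : Fin n ≃ Fin n, e.toEmbedding.equivOfFiniteSelfEmbedding = e := fun e => by
      ext i; rfl
    simp only [h, Equiv.symm_symm]
    ext i; rfl

/-- The coordinate description of `inversionPerm`: the `j`-th entry is `i` iff `s_i = j`. -/
theorem inversionPerm_apply_eq_iff {n : ℕ} (s : Tuples n n) (i j : Fin n) :
    inversionPerm n s j = i ↔ s i = j := by
  change s.equivOfFiniteSelfEmbedding.symm j = i ↔ s i = j
  rw [Equiv.symm_apply_eq]
  exact eq_comm

/-! In each case the graph is replaced by one whose adjacency is a smallest possible change, and the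
automorphisms of that graph are pinned down by their effect near one vertex.

For `r = k < n`, adjacency means disagreeing everywhere. Call distinct tuples close if they differ
in one coordinate (`DiffOne`). Among distinct pairs, close pairs are exactly those with the most
common neighbours: `exists_card_avoiding_lt` improves any other pair, and `card_avoiding_of_diffOne`
makes the count constant on close pairs. Hence automorphisms preserve closeness. After composing
with some `P g`, an automorphism fixes a tuple `s`. The way it permutes the tuples close to `s`
defines a coordinate permutation and a symbol permutation (`exists_eq_of_diffOne_of_fixed`).
Dividing these out leaves a map that fixes `s` and everything close to it; this property spreads
along close pairs (`fixed_of_diffOne`), which connect all tuples when `k < n`.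

For `k = n`, tuples are permutations, and the relevant graph is the Cayley graph in which `x` and
`y` are joined when `x⁻¹ * y` is a transposition. For `r = 2` this is the given graph. For `r = n`,
counting derangements that meet a given permutation singles it out: among nonidentity permutations
with a fixed point, the transpositions are met by the fewest derangements (`card_meeting_lt`).

An automorphism of the Cayley graph may be translated to fix `1`. Common neighbours show that it
preserves overlap of transpositions and the triangles given by 3-cycles, so it acts on
transpositions as a conjugation (`PresSwap.exists_apply_swap`). Once that is removed, every 3-cycle
goes to itself or its inverse, with the same choice for all of them; inversion removes the second
possibility. What remains fixes `1`, all transpositions and all 3-cycles, and induction on words in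
transpositions makes it trivial (`PresSwap.eq_one`). So automorphisms have the form `x ↦ g * x * q`
or `x ↦ g * x⁻¹ * q`. -/

open Equiv

/-! ### Assembling internal products from homomorphisms into the vertex permutations -/

theorem exists_mulEquiv_graphAut {V L : Type*} [Group L] (Γ : SimpleGraph V) (F : L →* Perm V)
    (hinj : Function.Injective F) (hF : ∀ x s t, Γ.Adj (F x s) (F x t) ↔ Γ.Adj s t)
    (hsurj : ∀ f : Γ ≃g Γ, ∃ x, F x = f.toEquiv) :
    ∃ e : L ≃* (Γ ≃g Γ), ∀ x, (e x).toEquiv = F x := by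
  refine ⟨MulEquiv.mk (Equiv.ofBijective (fun x => (⟨F x, hF x _ _⟩ : Γ ≃g Γ)) ⟨?_, ?_⟩) ?_, ?_⟩
  · intro x y h
    exact hinj (congrArg RelIso.toEquiv h)
  · intro f
    obtain ⟨x, hx⟩ := hsurj f
    exact ⟨x, RelIso.toEquiv_injective hx⟩
  · intro x y
    apply RelIso.toEquiv_injective
    exact map_mul F x y
  · intro x
    rfl

/-- If `h` normalizes the image of an injective homomorphism `ι : K →* G` and the image of `ι` is
disjoint from `⟨h⟩`, then `K ⋊ ⟨h⟩` embeds in `G`. -/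
theorem exists_semidirect_hom {G K : Type*} [Group G] [Group K] (ι : K →* G)
    (hι : Function.Injective ι) (h : G) (hnorm : h ∈ Subgroup.normalizer (ι.range : Set G))
    (hdisj : Disjoint ι.range (Subgroup.zpowers h)) :
    ∃ (φ : Subgroup.zpowers h →* MulAut K) (F : (K ⋊[φ] Subgroup.zpowers h) →* G),
      Function.Injective F ∧ ∀ x, F x = ι x.left * (x.right : G) := by
  have hle : Subgroup.zpowers h ≤ Subgroup.normalizer (ι.range : Set G) := by
    rwa [Subgroup.zpowers_le]
  let e : K ≃* ι.range := MonoidHom.ofInjective hι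
  let φ : Subgroup.zpowers h →* MulAut K :=
    ((MulAut.congr e.symm).toMonoidHom.comp ι.range.normalizerMonoidHom).comp
      (Subgroup.inclusion hle)
  have hφ : ∀ (z : Subgroup.zpowers h) (x : K), ι (φ z x) = z * ι x * (z : G)⁻¹ := by
    intro z x
    have : e (φ z x) = ι.range.normalizerMonoidHom (Subgroup.inclusion hle z) (e x) := by
      change e (e.symm _) = _
      rw [MulEquiv.apply_symm_apply]
      rfl
    exact congrArg Subtype.val this
  let F : (K ⋊[φ] Subgroup.zpowers h) →* G :=
    SemidirectProduct.lift ι (Subgroup.zpowers h).subtype (by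
      intro z
      ext x
      simp [hφ])
  have hF : ∀ x, F x = ι x.left * (x.right : G) := by
    intro x
    simp [F, SemidirectProduct.lift]
  refine ⟨φ, F, ?_, hF⟩
  rw [injective_iff_map_eq_one]
  intro x hx
  rw [hF] at hx
  have h1 : ι x.left = ((x.right : G))⁻¹ := eq_inv_of_mul_eq_one_left hx
  have h2 : ι x.left = 1 := by
    have := Subgroup.disjoint_def.1 hdisj ⟨x.left, rfl⟩ (by
      rw [h1]; exact inv_mem x.right.2)
    exact this
  have h3 : x.left = 1 := hι (by rw [h2, map_one])
  have h4 : x.right = 1 := by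
    rw [h2] at h1
    exact Subtype.ext (by simpa using h1.symm)
  exact SemidirectProduct.ext h3 h4

/-! ### Symbol and coordinate permutations; tuples differing in one coordinate -/

@[simp] theorem symbolPerm_apply {n k : ℕ} (g : Perm (Fin n)) (s : Tuples n k) (i : Fin k) :
    symbolPerm n k g s i = g (s i) := rfl

@[simp] theorem coordPerm_apply_apply {n k : ℕ} (q : Perm (Fin k)) (s : Tuples n k) (i : Fin k) :
    coordPerm n k q s (q i) = s i := congrArg s (q.symm_apply_apply i)

theorem commute_symbolPerm_coordPerm {n k : ℕ} (g : Perm (Fin n)) (q : Perm (Fin k)) :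
    Commute (symbolPerm n k g) (coordPerm n k q) := by
  ext s i
  rfl

theorem exists_symbolPerm_eq {n k : ℕ} (s t : Tuples n k) : ∃ g, symbolPerm n k g s = t := by
  have := Equiv.Perm.isMultiplyPretransitive (Fin n) k
  obtain ⟨g, hg⟩ := MulAction.exists_smul_eq (Perm (Fin n)) s t
  exact ⟨g, by rw [← hg]; rfl⟩

/-- The tuples `s` and `t` differ at the coordinate `i` and nowhere else. -/
def DiffAt {n k : ℕ} (i : Fin k) (s t : Tuples n k) : Prop := s i ≠ t i ∧ ∀ j ≠ i, s j = t j

/-- The tuples `s` and `t` differ in exactly one coordinate. -/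
def DiffOne {n k : ℕ} (s t : Tuples n k) : Prop := ∃ i, DiffAt i s t

/-- The tuple `s` with the entry at `i` replaced by the symbol `b`, provided `b` is not in `s`. -/
def replace {n k : ℕ} (s : Tuples n k) (i : Fin k) (b : Fin n) : Tuples n k :=
  symbolPerm n k (swap (s i) b) s

@[simp] theorem replace_self {n k : ℕ} (s : Tuples n k) (i : Fin k) (b : Fin n) :
    replace s i b i = b := by simp [replace]

theorem replace_ne {n k : ℕ} {s : Tuples n k} {i j : Fin k} {b : Fin n} (hb : ∀ j, s j ≠ b)
    (h : j ≠ i) : replace s i b j = s j := by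
  simp only [replace, symbolPerm_apply]
  exact swap_apply_of_ne_of_ne (fun h' => h (s.injective h')) (hb j)

theorem diffAt_replace {n k : ℕ} {s : Tuples n k} (i : Fin k) {b : Fin n} (hb : ∀ j, s j ≠ b) :
    DiffAt i s (replace s i b) :=
  ⟨by simpa using hb i, fun _ h => (replace_ne hb h).symm⟩

theorem DiffAt.eq_replace {n k : ℕ} {s t : Tuples n k} {i : Fin k} (h : DiffAt i s t) :
    (∀ j, s j ≠ t i) ∧ t = replace s i (t i) := by
  have h1 : ∀ j, s j ≠ t i := by
    intro j
    by_cases hj : j = i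
    · rw [hj]; exact h.1
    · rw [h.2 j hj]; exact fun e => hj (t.injective e)
  refine ⟨h1, ?_⟩
  ext j
  by_cases hj : j = i
  · subst hj; simp
  · rw [replace_ne h1 hj, h.2 j hj]

theorem DiffOne.ne {n k : ℕ} {s t : Tuples n k} (h : DiffOne s t) : s ≠ t := by
  rintro rfl
  exact h.choose_spec.1 rfl

theorem DiffAt.unique {n k : ℕ} {s t : Tuples n k} {i j : Fin k} (h : DiffAt i s t)
    (h' : DiffAt j s t) : i = j := by
  by_contra hne
  exact h.1 (h'.2 i hne)

/-- Tuples differing in one coordinate from a common neighbour are related iff the coordinate is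
the same. -/
theorem DiffAt.trans_iff {n k : ℕ} {s t u : Tuples n k} {i j : Fin k} (h : DiffAt i s t)
    (h' : DiffAt j s u) (hne : t ≠ u) : DiffOne t u ↔ i = j := by
  constructor
  · rintro ⟨m, hm⟩
    by_contra hij
    have h1 := h.2; have h2 := h'.2; have h3 := hm.2; have h4 := h.1; have h5 := h'.1
    grind
  · rintro rfl
    refine ⟨i, fun e => hne ?_, fun j hj => ?_⟩
    · ext j
      by_cases hj : j = i
      · rw [hj, e]
      · rw [← h.2 j hj, ← h'.2 j hj]
    · rw [← h.2 j hj, ← h'.2 j hj]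

/-- The common neighbours of `t = s[i := t i]` and `v = s[j := v j]`. -/
theorem eq_of_diffOne_of_diffOne {n k : ℕ} {s t v w : Tuples n k} {i j : Fin k} (hij : i ≠ j)
    (ht : DiffAt i s t) (hv : DiffAt j s v) (hw : DiffOne t w) (hw' : DiffOne v w) :
    w = s ∨ (w i = t i ∧ w j = v j ∧ ∀ m, m ≠ i → m ≠ j → w m = s m) := by
  obtain ⟨p, hp⟩ := hw
  obtain ⟨p', hp'⟩ := hw'
  have h1 := ht.1; have h2 := ht.2; have h3 := hv.1; have h4 := hv.2
  have h5 := hp.2; have h6 := hp'.2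
  -- `t` and `v` disagree at both `i` and `j`, while `w` is one change away from each, so the two
  -- changes happen at `i` and `j`. Changing `t` at `i` leads back to `s`; changing it at `j` gives
  -- the fourth corner of the square.
  have : p = i ∨ p = j := by grind
  rcases this with rfl | rfl
  · left
    have hp2 : p' = j := by grind
    subst hp2
    ext m
    by_cases hm : m = p <;> grind
  · right
    have hp2 : p' = i := by grind
    subst hp2
    refine ⟨by grind, by grind, by grind⟩

/-! ### Rigidity of the one-coordinate graph for `k < n` -/

section

variable {n k : ℕ} {f : Perm (Tuples n k)} (hf : ∀ s t, DiffOne (f s) (f t) ↔ DiffOne s t)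

include hf

/-- Either `u` is `s` or one of its neighbours, or the symbol `u j` does not occur in `s`. In the
latter case `u` is the only common neighbour, apart from `s`, of the two fixed tuples `t` and
`replace s j (u j)`. -/
theorem fixed_of_easy {s t u : Tuples n k} {i j : Fin k} (hs : f s = s)
    (hN : ∀ t, DiffOne s t → f t = t) (ht : DiffAt i s t) (hu : DiffAt j t u)
    (h : j = i ∨ u j ≠ s i) : f u = u := by
  by_cases hji : j = i
  · subst hji
    by_cases hsu : s = u
    · rw [← hsu, hs]
    · apply hN
      exact ⟨j, fun e => hsu (by
        ext m
        by_cases hm : m = j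
        · rw [hm, e]
        · rw [ht.2 m hm, hu.2 m hm]), fun m hm => by rw [ht.2 m hm, hu.2 m hm]⟩
  · have hc : u j ≠ s i := h.resolve_left hji
    have h1 := ht.2; have h2 := hu.2; have h3 := ht.1; have h4 := hu.1
    have hout : ∀ m, s m ≠ u j := by
      intro m
      by_cases hm : m = i
      · rw [hm]; exact hc.symm
      · rw [h1 m hm]; exact hu.eq_replace.1 m
    have hv := diffAt_replace j hout
    have hvu : DiffOne (replace s j (u j)) u := by
      refine ⟨i, ?_, fun m hm => ?_⟩
      · rw [replace_ne hout (Ne.symm hji)]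
        rw [← h2 i (Ne.symm hji)]; exact h3
      · by_cases hmj : m = j
        · rw [hmj, replace_self]
        · rw [replace_ne hout hmj, h1 m hm, h2 m hmj]
    have hfv := hN _ ⟨j, hv⟩
    have hft := hN _ ⟨i, ht⟩
    have e1 : DiffOne t (f u) := by rw [← hft, hf]; exact ⟨j, hu⟩
    have e2 : DiffOne (replace s j (u j)) (f u) := by rw [← hfv, hf]; exact hvu
    rcases eq_of_diffOne_of_diffOne (Ne.symm hji) ht hv e1 e2 with h | ⟨ha, hb, hc⟩
    · rw [← hs] at h
      have := f.injective h
      subst this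
      exact absurd (h2 i (Ne.symm hji)) (Ne.symm h3)
    · ext m
      by_cases hm : m = i
      · rw [hm, ha, h2 i (Ne.symm hji)]
      · by_cases hmj : m = j
        · rw [hmj, hb, replace_self]
        · rw [hc m hm hmj, h1 m hm, h2 m hmj]

/-- The case left by `fixed_of_easy` is the one where `u` reuses at `j` the symbol `s i` displaced
from `i`. Then `f u` is of the same kind, with a slot `j'` in place of `j`. The auxiliary tuple `w`
carries `t i` at `j` and `s j` at `i`; together with `x`, which is `s` with slots `i` and `j`
exchanged, it detects `j'`. -/
theorem fixed_of_diffOne {s t u : Tuples n k} (hs : f s = s)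
    (hN : ∀ t, DiffOne s t → f t = t) (ht : DiffOne s t) (hu : DiffOne t u) : f u = u := by
  obtain ⟨i, ht⟩ := ht
  obtain ⟨j, hu⟩ := hu
  by_cases hE : j = i ∨ u j ≠ s i
  · exact fixed_of_easy hf hs hN ht hu hE
  push Not at hE
  obtain ⟨hji, hc⟩ := hE
  have hft := hN _ ⟨i, ht⟩
  have e1 : DiffOne t (f u) := by rw [← hft, hf]; exact ⟨j, hu⟩
  obtain ⟨j', hj'⟩ := e1
  by_cases hE' : j' = i ∨ (f u) j' ≠ s i
  · exact f.injective (fixed_of_easy hf hs hN ht hj' hE')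
  push Not at hE'
  obtain ⟨hji', hc'⟩ := hE'
  have hb : ∀ m, s m ≠ t i := ht.eq_replace.1
  have hv := diffAt_replace j hb
  set v := replace s j (t i) with hvdef
  have hvj : v j = t i := by simp [hvdef]
  have hvo : ∀ m, m ≠ j → v m = s m := fun m hm => replace_ne hb hm
  have hsj : ∀ m, v m ≠ s j := by
    intro m
    by_cases hm : m = j
    · rw [hm, hvj]; exact (hb j).symm
    · rw [hvo m hm]; exact fun e => hm (s.injective e)
  have hw := diffAt_replace i hsj
  set w := replace v i (s j) with hwdef
  have hwi : w i = s j := by simp [hwdef]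
  have hwo : ∀ m, m ≠ i → w m = v m := fun m hm => replace_ne hsj hm
  have hfv := hN _ ⟨j, hv⟩
  -- `u` and `w` have a common neighbour
  have hsi : ∀ m, w m ≠ s i := by
    intro m
    by_cases hm : m = i
    · rw [hm, hwi]; exact fun e => hji (s.injective e)
    · rw [hwo m hm]
      by_cases hm' : m = j
      · rw [hm', hvj]; exact (hb i).symm
      · rw [hvo m hm']; exact fun e => hm (s.injective e)
  have hx := diffAt_replace j hsi
  set x := replace w j (s i) with hxdef
  have hxj : x j = s i := by simp [hxdef]
  have hxo : ∀ m, m ≠ j → x m = w m := fun m hm => replace_ne hsi hm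
  have h1 := ht.2; have h2 := hu.2; have h3 := ht.1; have h4 := hu.1
  have hxu : DiffOne u x := by
    refine ⟨i, ?_, fun m hm => ?_⟩
    · rw [hxo i (Ne.symm hji), hwi, ← h2 i (Ne.symm hji)]
      exact (hb j).symm
    · by_cases hmj : m = j
      · rw [hmj, hxj, hc]
      · rw [hxo m hmj, hwo m hm, hvo m hmj, ← h2 m hmj, h1 m hm]
  obtain ⟨p, hp⟩ := (hf _ _).2 hxu
  obtain ⟨q, hq⟩ := (hf _ _).2 ⟨j, hx⟩
  have e2 : DiffOne v (f w) := by rw [← hfv, hf]; exact ⟨i, hw⟩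
  obtain ⟨i', hi'⟩ := e2
  have hij' : i' ≠ j := by
    rintro rfl
    have := f.injective (fixed_of_easy hf hs hN hv hi' (Or.inl rfl))
    rw [this] at hi'
    exact hji (hi'.unique hw)
  have hwj : f w j = t i := by rw [← hi'.2 j (Ne.symm hij'), hvj]
  have hui : f u i = t i := (hj'.2 i (Ne.symm hji')).symm
  -- `f u` and `f w` have the common neighbour `f x`, so they differ in at most two coordinates. If
  -- `j' ≠ j`, they would differ at the three coordinates `i`, `j`, `j'`.
  have hjj : j' = j := by
    by_contra hne
    have d1 : f u i ≠ f w i := by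
      rw [hui, ← hwj]; exact fun e => hji ((f w).injective e)
    have d2 : f u j ≠ f w j := by
      rw [hwj, ← hui]; exact fun e => hji ((f u).injective e)
    have d3 : f u j' ≠ f w j' := by
      rw [hc']
      by_cases h' : i' = j'
      · have : f w i = s i := by rw [← hi'.2 i (by rw [h']; exact Ne.symm hji'), hvo i (Ne.symm hji)]
        rw [← this]
        exact fun e => hji' ((f w).injective e).symm
      · rw [← hi'.2 j' (Ne.symm h'), hvo j' hne]
        exact fun e => hji' (s.injective e).symm
    have hp2 := hp.2; have hq2 := hq.2
    grind
  subst hjj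
  ext m
  by_cases hm : m = j'
  · rw [hm, hc', hc]
  · rw [← hj'.2 m hm, h2 m hm]

end

theorem exists_forall_ne {n k : ℕ} (hkn : k < n) (s : Tuples n k) : ∃ b, ∀ j, s j ≠ b := by
  by_contra! h
  have := Fintype.card_le_of_surjective s h
  simp at this
  omega

/-- For `k < n`, moving in one coordinate at a time reaches every tuple. -/
theorem forall_of_diffOne {n k : ℕ} (hkn : k < n) (S : Tuples n k → Prop)
    (hS : ∀ s t, DiffOne s t → S s → S t) (s : Tuples n k) (hs : S s) (t : Tuples n k) : S t := by
  have key : ∀ (x y : Fin n) (s : Tuples n k), (∀ j, s j ≠ y) → S s →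
      S (symbolPerm n k (swap x y) s) := by
    intro x y s hy h
    by_cases hx : ∃ i, s i = x
    · obtain ⟨i, rfl⟩ := hx
      exact hS _ _ ⟨i, diffAt_replace i hy⟩ h
    · push Not at hx
      convert h
      ext i
      simp [swap_apply_of_ne_of_ne (hx i) (hy i)]
  have hswap : ∀ (x y : Fin n) (s : Tuples n k), S s → S (symbolPerm n k (swap x y) s) := by
    intro x y s h
    by_cases hxy : x = y
    · subst hxy; simpa [← Perm.one_def] using h
    by_cases hy : ∃ j, s j = y
    · by_cases hx : ∃ i, s i = x
      · obtain ⟨b, hb⟩ := exists_forall_ne hkn s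
        obtain ⟨i, rfl⟩ := hx
        obtain ⟨j, rfl⟩ := hy
        have hij : i ≠ j := fun e => hxy (by rw [e])
        -- Both symbols are in use, so they are exchanged through a spare symbol `b` in three
        -- one-coordinate moves.
        have h1 := key (s i) b s hb h
        have h2 := key (s j) (s i) _ (fun m => by
          simp only [symbolPerm_apply]
          have := hb i; have := hb m
          rw [swap_apply_def]; grind) h1
        have h3 := key b (s j) _ (fun m => by
          have h4 := hb i; have h5 := hb m; have h6 := hb j
          simp only [symbolPerm_apply, swap_apply_def]; grind) h2
        convert h3 using 1
        ext m
        have h4 := hb i; have h5 := hb m; have h6 := hb j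
        simp only [symbolPerm_apply, swap_apply_def]; grind
      · push Not at hx
        rw [swap_comm]
        exact key y x s hx h
    · push Not at hy
      exact key x y s hy h
  obtain ⟨g, rfl⟩ := exists_symbolPerm_eq s t
  induction g using Perm.swap_induction_on with
  | one => simpa using hs
  | swap_mul g x y _ ih =>
    rw [map_mul]
    exact hswap _ _ _ ih

theorem eq_one_of_fixed {n k : ℕ} (hkn : k < n) {f : Perm (Tuples n k)}
    (hf : ∀ s t, DiffOne (f s) (f t) ↔ DiffOne s t) {s : Tuples n k} (hs : f s = s)
    (hN : ∀ t, DiffOne s t → f t = t) : f = 1 := by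
  ext1 t
  refine (forall_of_diffOne hkn (fun s => f s = s ∧ ∀ t, DiffOne s t → f t = t) ?_ s ⟨hs, hN⟩ t).1
  rintro s t hst ⟨h1, h2⟩
  exact ⟨h2 t hst, fun u hu => fixed_of_diffOne hf h1 h2 hst hu⟩

theorem diffOne_symbolPerm_mul_coordPerm {n k : ℕ} (g : Perm (Fin n)) (q : Perm (Fin k))
    (s t : Tuples n k) :
    DiffOne ((symbolPerm n k g * coordPerm n k q) s) ((symbolPerm n k g * coordPerm n k q) t) ↔
      DiffOne s t := by
  unfold DiffOne
  rw [← q.exists_congr_right]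
  refine exists_congr fun i => ?_
  simp only [DiffAt, Perm.mul_apply, symbolPerm_apply, ne_eq, g.injective.eq_iff,
    coordPerm_apply_apply]
  refine and_congr Iff.rfl ?_
  constructor
  · intro h j hj
    simpa using h (q j) (by simpa using hj)
  · intro h j hj
    obtain ⟨m, rfl⟩ := q.surjective j
    simpa using h m (by rintro rfl; exact hj rfl)

/-- The neighbours of `s` fall into cliques indexed by the changed slot, so `f` permutes slots by
some `σ`. The new symbol is transformed by a map `β` that does not depend on the slot, and `β`
together with `σ` determines the symbol permutation. -/
theorem exists_eq_of_diffOne_of_fixed {n k : ℕ} (hk : 1 ≤ k) (hkn : k < n) {f : Perm (Tuples n k)}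
    (hf : ∀ s t, DiffOne (f s) (f t) ↔ DiffOne s t) {s : Tuples n k} (hs : f s = s) :
    ∃ g q, f = symbolPerm n k g * coordPerm n k q := by
  obtain ⟨b₀, hb₀⟩ := exists_forall_ne hkn s
  have hfs : ∀ i b, (∀ j, s j ≠ b) → DiffOne s (f (replace s i b)) := by
    intro i b hb
    nth_rw 1 [← hs]
    rw [hf]
    exact ⟨i, diffAt_replace i hb⟩
  choose σ hσ using fun i => hfs i b₀ hb₀
  have hne : ∀ i j b c, i ≠ j → (∀ m, s m ≠ b) → (∀ m, s m ≠ c) →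
      replace s i b ≠ replace s j c := by
    intro i j b c hij hb hc h
    have := DFunLike.congr_fun h i
    rw [replace_self, replace_ne hc hij] at this
    exact hb i this.symm
  have hσ' : ∀ i b, (∀ j, s j ≠ b) → DiffAt (σ i) s (f (replace s i b)) := by
    intro i b hb
    by_cases hbb : b = b₀
    · rw [hbb]; exact hσ i
    obtain ⟨m, hm⟩ := hfs i b hb
    have hne' : replace s i b ≠ replace s i b₀ := fun h => hbb (by
      simpa using DFunLike.congr_fun h i)
    have h1 : DiffOne (replace s i b) (replace s i b₀) :=
      ((diffAt_replace i hb).trans_iff (diffAt_replace i hb₀) hne').2 rfl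
    have h2 := (hm.trans_iff (hσ i) (f.injective.ne hne')).1 ((hf _ _).2 h1)
    rwa [← h2]
  have hσinj : Function.Injective σ := by
    intro i j hij
    by_contra h
    have hne' := hne i j b₀ b₀ h hb₀ hb₀
    have h1 := ((hσ i).trans_iff (hσ j) (f.injective.ne hne')).2 hij
    rw [hf, (diffAt_replace i hb₀).trans_iff (diffAt_replace j hb₀) hne'] at h1
    exact h h1
  let i₀ : Fin k := ⟨0, hk⟩
  let β : Fin n → Fin n := fun b => f (replace s i₀ b) (σ i₀)
  have hβ : ∀ i b, (∀ j, s j ≠ b) → f (replace s i b) (σ i) = β b := by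
    intro i b hb
    by_cases hi : i = i₀
    · rw [hi]
    by_contra hc
    have hA := hσ' i b hb
    have hB := hσ' i₀ b hb
    have hσne : σ i ≠ σ i₀ := hσinj.ne hi
    have hcA : ∀ m, f (replace s i b) m ≠ β b := by
      intro m
      by_cases hm : m = σ i
      · rw [hm]; exact hc
      · rw [← hA.2 m hm]
        exact hB.eq_replace.1 m
    -- If the two new symbols differed, `w` would be a common neighbour of both images other than
    -- `s`. But `replace s i b` and `replace s i₀ b` have only `s` in common, since the fourth
    -- corner would contain `b` twice.
    have hwA := diffAt_replace (σ i₀) hcA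
    set w := replace (f (replace s i b)) (σ i₀) (β b) with hw
    have hwB : DiffOne (f (replace s i₀ b)) w := by
      refine ⟨σ i, ?_, fun m hm => ?_⟩
      · rw [hw, replace_ne hcA hσne, ← hB.2 _ hσne]
        exact hA.1
      · by_cases hm' : m = σ i₀
        · rw [hm', hw, replace_self]
        · rw [hw, replace_ne hcA hm', ← hB.2 _ hm', ← hA.2 _ hm]
    have h1 : DiffOne (replace s i b) (f.symm w) := by
      rw [← hf, apply_symm_apply]; exact ⟨_, hwA⟩
    have h2 : DiffOne (replace s i₀ b) (f.symm w) := by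
      rw [← hf, apply_symm_apply]; exact hwB
    rcases eq_of_diffOne_of_diffOne hi (diffAt_replace i hb) (diffAt_replace i₀ hb) h1 h2 with
      h | ⟨h, h', -⟩
    · rw [symm_apply_eq, hs] at h
      have := hB.2 (σ i) hσne
      have h3 : w (σ i) = s (σ i) := by rw [h]
      rw [hw, replace_ne hcA hσne] at h3
      exact hA.1 h3.symm
    · rw [replace_self] at h h'
      exact hi ((f.symm w).injective (h.trans h'.symm))
  have hβout : ∀ b, (∀ j, s j ≠ b) → ∀ j, s j ≠ β b := fun b hb =>
    (hσ' i₀ b hb).eq_replace.1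
  have hβinj : ∀ b c, (∀ j, s j ≠ b) → (∀ j, s j ≠ c) → β b = β c → b = c := by
    intro b c hb hc h
    have h1 := (hσ' i₀ b hb).eq_replace.2
    have h2 := (hσ' i₀ c hc).eq_replace.2
    have h3 : f (replace s i₀ b) = f (replace s i₀ c) := by
      rw [h1, h2]; exact congrArg _ h
    simpa using DFunLike.congr_fun (f.injective h3) i₀
  -- Symbols of `s` follow their slots under `σ`, which is what makes the product fix `s`; the other
  -- symbols follow `β`.
  let γ : Fin n → Fin n := Function.extend s (s ∘ σ) β
  have hγs : ∀ i, γ (s i) = s (σ i) := fun i => s.injective.extend_apply _ _ i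
  have hγb : ∀ b, (∀ j, s j ≠ b) → γ b = β b := fun b hb =>
    Function.extend_apply' _ _ _ (by simpa using hb)
  have hγinj : Function.Injective γ := by
    intro x y hxy
    by_cases hx : ∃ i, s i = x
    · obtain ⟨i, rfl⟩ := hx
      by_cases hy : ∃ j, s j = y
      · obtain ⟨j, rfl⟩ := hy
        rw [hγs, hγs] at hxy
        rw [hσinj (s.injective hxy)]
      · push Not at hy
        rw [hγs, hγb y hy] at hxy
        exact absurd hxy (hβout y hy _)
    · push Not at hx
      by_cases hy : ∃ j, s j = y
      · obtain ⟨j, rfl⟩ := hy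
        rw [hγs, hγb x hx] at hxy
        exact absurd hxy.symm (hβout x hx _)
      · push Not at hy
        rw [hγb x hx, hγb y hy] at hxy
        exact hβinj x y hx hy hxy
  let g : Perm (Fin n) := Equiv.ofBijective γ (Finite.injective_iff_bijective.1 hγinj)
  let q : Perm (Fin k) := Equiv.ofBijective σ (Finite.injective_iff_bijective.1 hσinj)
  have hg : ∀ x, g x = γ x := fun _ => rfl
  have hq : ∀ i, q i = σ i := fun _ => rfl
  refine ⟨g, q, ?_⟩
  have hPs : (symbolPerm n k g * coordPerm n k q) s = s := by
    ext i
    obtain ⟨j, rfl⟩ := q.surjective i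
    simp only [Perm.mul_apply, symbolPerm_apply, coordPerm_apply_apply, hg]
    rw [hγs, hq]
  have hPt : ∀ t, DiffOne s t → (symbolPerm n k g * coordPerm n k q) t = f t := by
    rintro t ⟨i, ht⟩
    obtain ⟨hout, heq⟩ := ht.eq_replace
    rw [heq]
    set b := t i
    have hA := hσ' i b hout
    ext m
    obtain ⟨j, rfl⟩ := q.surjective m
    simp only [Perm.mul_apply, symbolPerm_apply, coordPerm_apply_apply, hg]
    by_cases hj : j = i
    · rw [hj, replace_self, hγb b hout, hq, hβ i b hout]
    · rw [replace_ne hout hj, hγs, hq, hA.2 (σ j) (hσinj.ne hj)]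
  set p := symbolPerm n k g * coordPerm n k q with hp
  have h1 : p⁻¹ * f = 1 := by
    apply eq_one_of_fixed hkn (s := s)
    · intro x y
      rw [← diffOne_symbolPerm_mul_coordPerm g q, ← hp]
      simp [hf]
    · rw [Perm.mul_apply, hs, Perm.inv_eq_iff_eq, hPs]
    · intro t ht
      rw [Perm.mul_apply, Perm.inv_eq_iff_eq, hPt t ht]
  exact (inv_mul_eq_one.1 h1).symm

theorem exists_eq_of_diffOne {n k : ℕ} (hk : 1 ≤ k) (hkn : k < n) {f : Perm (Tuples n k)}
    (hf : ∀ s t, DiffOne (f s) (f t) ↔ DiffOne s t) :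
    ∃ g q, f = symbolPerm n k g * coordPerm n k q := by
  let s : Tuples n k := Fin.castLEEmb hkn.le
  obtain ⟨g₀, hg₀⟩ := exists_symbolPerm_eq s (f s)
  have h := diffOne_symbolPerm_mul_coordPerm (k := k) g₀⁻¹ 1
  simp only [map_one, mul_one] at h
  obtain ⟨g, q, hgq⟩ := exists_eq_of_diffOne_of_fixed hk hkn
    (f := symbolPerm n k g₀⁻¹ * f) (s := s) (fun x y => by
      simp only [Perm.mul_apply, h, hf]) (by
      rw [Perm.mul_apply, ← hg₀, map_inv, Perm.inv_eq_iff_eq])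
  refine ⟨g₀ * g, q, ?_⟩
  rw [map_mul, mul_assoc, ← hgq, map_inv, mul_inv_cancel_left]

/-! ### Recovering one-coordinate difference from total disagreement, `k < n` -/

theorem finRotate_ne {n : ℕ} (hn : 2 ≤ n) (i : Fin n) : finRotate n i ≠ i := by
  obtain ⟨m, rfl⟩ := Nat.exists_eq_add_of_le' hn
  have := Finset.mem_univ i
  rwa [← support_finRotate, Perm.mem_support] at this

/-- A conjugate of the full cycle, chosen by moving the image of `i` to `j`. -/
theorem exists_derangement_apply_eq {n : ℕ} {i j : Fin n} (h : i ≠ j) :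
    ∃ x : Perm (Fin n), (∀ m, x m ≠ m) ∧ x i = j := by
  have hn : 2 ≤ n := by
    have := i.2; have := j.2
    have : (i : ℕ) ≠ j := fun e => h (Fin.ext e)
    omega
  let r := finRotate n
  let τ := swap (r i) j
  refine ⟨τ * r * τ⁻¹, fun m e => ?_, ?_⟩
  · rw [Perm.mul_apply, Perm.mul_apply, ← Perm.eq_inv_iff_eq] at e
    exact finRotate_ne hn _ e
  · have : τ⁻¹ i = i := by
      rw [swap_inv]
      exact swap_apply_of_ne_of_ne (finRotate_ne hn i).symm h
    rw [Perm.mul_apply, Perm.mul_apply, this]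
    exact swap_apply_left _ _

/-- The tuples that differ from both `s` and `t` in every coordinate. -/
noncomputable def avoiding {n k : ℕ} (s t : Tuples n k) : Finset (Tuples n k) :=
  Finset.univ.filter fun x => ∀ i, x i ≠ s i ∧ x i ≠ t i

theorem mem_avoiding {n k : ℕ} {s t x : Tuples n k} :
    x ∈ avoiding s t ↔ ∀ i, x i ≠ s i ∧ x i ≠ t i := by simp [avoiding]

theorem card_avoiding_eq {n k : ℕ} {f : Perm (Tuples n k)}
    (hf : ∀ s t, (∀ i, f s i ≠ f t i) ↔ ∀ i, s i ≠ t i) (s t : Tuples n k) :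
    (avoiding (f s) (f t)).card = (avoiding s t).card := by
  symm
  refine Finset.card_equiv f fun x => ?_
  simp only [mem_avoiding, forall_and, hf]

/-- If `t` uses a symbol foreign to `s`, copying just that symbol into `s` relaxes the constraints
and enlarges the avoiding set. If `t` uses only symbols of `s`, then `t` forbids at some slot a
symbol of `s`, which costs more than forbidding a foreign symbol there. -/
theorem exists_card_avoiding_lt {n k : ℕ} (hkn : k < n) {s t : Tuples n k} (hst : s ≠ t)
    (h1 : ¬ DiffOne s t) :
    ∃ t', DiffOne s t' ∧ (avoiding s t).card < (avoiding s t').card := by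
  by_cases hout : ∃ i, ∀ m, s m ≠ t i
  · obtain ⟨i, hi⟩ := hout
    refine ⟨replace s i (t i), ⟨i, diffAt_replace i hi⟩, Finset.card_lt_card ?_⟩
    rw [Finset.ssubset_iff_of_subset]
    · obtain ⟨j, hji, hj⟩ : ∃ j, j ≠ i ∧ s j ≠ t j := by
        by_contra! h
        exact h1 ⟨i, hi i, h⟩
      -- The witness of strictness avoids `s` but meets `t` at `j`. Deranging the slots of `s` keeps
      -- the foreign symbol `t i` out of slot `i`. If `t j` occurs in `s`, the derangement brings it
      -- to slot `j`; otherwise it is written there afterwards.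
      have key : ∃ x : Tuples n k, (∀ m, x m ≠ s m) ∧ x j = t j ∧ x i ≠ t i := by
        by_cases hl : ∃ l, s l = t j
        · obtain ⟨l, hl⟩ := hl
          obtain ⟨π, hπ, hπj⟩ := exists_derangement_apply_eq
            (show j ≠ l by rintro rfl; exact hj hl)
          refine ⟨π.toEmbedding.trans s, fun m e => hπ m (s.injective e), ?_, (hi _)⟩
          exact (congrArg s hπj).trans hl
        · push Not at hl
          obtain ⟨π, hπ, -⟩ := exists_derangement_apply_eq hji
          let y : Tuples n k := π.toEmbedding.trans s
          have hy : ∀ m, y m ≠ t j := fun m => hl _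
          refine ⟨replace y j (t j), fun m => ?_, replace_self _ _ _, ?_⟩
          · by_cases hm : m = j
            · rw [hm, replace_self]; exact hj.symm
            · rw [replace_ne hy hm]; exact fun e => hπ m (s.injective e)
          · rw [replace_ne hy hji.symm]; exact hi _
      obtain ⟨x, hx, hxj, hxi⟩ := key
      refine ⟨x, mem_avoiding.2 fun m => ⟨hx m, ?_⟩, fun h => (mem_avoiding.1 h j).2 hxj⟩
      by_cases hm : m = i
      · rw [hm, replace_self]; exact hxi
      · rw [replace_ne hi hm]; exact hx m
    · intro x hx
      rw [mem_avoiding] at hx ⊢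
      intro m
      refine ⟨(hx m).1, ?_⟩
      by_cases hm : m = i
      · rw [hm, replace_self]; exact (hx i).2
      · rw [replace_ne hi hm]; exact (hx m).1
  · push Not at hout
    obtain ⟨b, hb⟩ := exists_forall_ne hkn s
    obtain ⟨i, hi⟩ : ∃ i, s i ≠ t i := by
      by_contra! h
      exact hst (by ext m; rw [h m])
    obtain ⟨l, hl⟩ := hout i
    have hil : i ≠ l := by rintro rfl; exact hi hl
    refine ⟨replace s i b, ⟨i, diffAt_replace i hb⟩, ?_⟩
    let N : Finset (Tuples n k) := Finset.univ.filter fun x => ∀ m, x m ≠ s m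
    have hN : ∀ x, x ∈ N ↔ ∀ m, x m ≠ s m := fun x => by simp [N]
    have hle : (avoiding s t).card ≤ (N.filter fun x => x i ≠ s l).card := by
      refine Finset.card_le_card fun x hx => ?_
      rw [mem_avoiding] at hx
      rw [Finset.mem_filter, hN, hl]
      exact ⟨fun m => (hx m).1, (hx i).2⟩
    have heq : avoiding s (replace s i b) = N.filter fun x => x i ≠ b := by
      ext x
      rw [mem_avoiding, Finset.mem_filter, hN]
      constructor
      · intro h
        exact ⟨fun m => (h m).1, by simpa using (h i).2⟩
      · rintro ⟨h, h'⟩ m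
        refine ⟨h m, ?_⟩
        by_cases hm : m = i
        · rw [hm, replace_self]; exact h'
        · rw [replace_ne hb hm]; exact h m
    -- Exchanging the symbols `b` and `s l` injects the left set into the right one. A tuple with `s
    -- l` at `i` and `b` at `l` is missed, because its preimage would agree with `s` at `l`.
    have hlt : (N.filter fun x => x i = b).card < (N.filter fun x => x i = s l).card := by
      rw [← Finset.card_map (symbolPerm n k (swap b (s l))).toEmbedding]
      apply Finset.card_lt_card
      rw [Finset.ssubset_iff_of_subset]
      · obtain ⟨π, hπ, hπi⟩ := exists_derangement_apply_eq hil
        let y : Tuples n k := π.toEmbedding.trans s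
        have hy : ∀ m, y m ≠ b := fun m => hb _
        refine ⟨replace y l b, ?_, ?_⟩
        · rw [Finset.mem_filter, hN]
          refine ⟨fun m => ?_, ?_⟩
          · by_cases hm : m = l
            · rw [hm, replace_self]; exact (hb l).symm
            · rw [replace_ne hy hm]; exact fun e => hπ m (s.injective e)
          · rw [replace_ne hy hil]; exact congrArg s hπi
        · rw [Finset.mem_map]
          rintro ⟨x, hx, hxy⟩
          rw [Finset.mem_filter, hN] at hx
          have := DFunLike.congr_fun hxy l
          rw [replace_self, toEmbedding_apply, symbolPerm_apply] at this
          exact hx.1 l ((swap b (s l)).injective (this.trans (swap_apply_right b (s l)).symm))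
      · intro z hz
        rw [Finset.mem_map] at hz
        obtain ⟨x, hx, rfl⟩ := hz
        rw [Finset.mem_filter, hN] at hx ⊢
        simp only [toEmbedding_apply, symbolPerm_apply]
        refine ⟨fun m e => ?_, by rw [hx.2, swap_apply_left]⟩
        have h2 := hx.1 m; have h3 := hb m
        by_cases hm : m = i
        · subst hm
          rw [hx.2, swap_apply_left] at e
          exact hil (s.injective e).symm
        · have : x m ≠ b := fun e => hm (x.injective (e.trans hx.2.symm))
          rw [swap_apply_def, if_neg this] at e
          split_ifs at e
          · exact h3 e.symm
          · exact h2 e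
    have e1 := Finset.card_filter_add_card_filter_not (s := N) (fun x => x i = b)
    have e2 := Finset.card_filter_add_card_filter_not (s := N) (fun x => x i = s l)
    rw [heq]
    simp only [ne_eq] at *
    omega

theorem disagree_symbolPerm_mul_coordPerm {n k : ℕ} (g : Perm (Fin n)) (q : Perm (Fin k))
    (s t : Tuples n k) :
    (∀ i, (symbolPerm n k g * coordPerm n k q) s i ≠ (symbolPerm n k g * coordPerm n k q) t i) ↔
      ∀ i, s i ≠ t i := by
  rw [← q.forall_congr_right]
  simp only [Perm.mul_apply, symbolPerm_apply, ne_eq, g.injective.eq_iff, coordPerm_apply_apply]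

/-- The maps `P g * Q q` act transitively on ordered close pairs: `q` aligns the changed slot, a
first symbol permutation matches the first tuple, and a swap of two symbols outside it matches the
second. -/
theorem card_avoiding_of_diffOne {n k : ℕ} {s t s' t' : Tuples n k} (h : DiffOne s t)
    (h' : DiffOne s' t') : (avoiding s t).card = (avoiding s' t').card := by
  have key : ∀ {s t s' t' : Tuples n k}, DiffOne s t → DiffOne s' t' →
      ∃ g q, (symbolPerm n k g * coordPerm n k q) s = s' ∧
        (symbolPerm n k g * coordPerm n k q) t = t' := by
    rintro s t s' t' ⟨i, h⟩ ⟨i', h'⟩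
    let q := swap i i'
    obtain ⟨g, hg⟩ := exists_symbolPerm_eq (coordPerm n k q s) s'
    let u := symbolPerm n k g (coordPerm n k q t)
    have hq : ∀ x : Tuples n k, coordPerm n k q x i' = x i := fun x => by
      conv_lhs => rw [← swap_apply_left i i']
      exact coordPerm_apply_apply q x i
    have hu : DiffAt i' s' u := by
      obtain ⟨j, hj⟩ := (diffOne_symbolPerm_mul_coordPerm g q s t).2 ⟨i, h⟩
      simp only [Perm.mul_apply, hg] at hj
      have h2 : s' i' ≠ u i' := by
        rw [← hg]
        simp only [u, symbolPerm_apply, ne_eq, g.injective.eq_iff, hq]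
        exact h.1
      by_cases hji : j = i'
      · rwa [hji] at hj
      · exact absurd (hj.2 i' (Ne.symm hji)) h2
    have h3 : ∀ m, s' m ≠ u i' := hu.eq_replace.1
    have h4 : ∀ m, s' m ≠ t' i' := h'.eq_replace.1
    refine ⟨swap (u i') (t' i') * g, q, ?_, ?_⟩
    · rw [map_mul]
      simp only [Perm.mul_apply, hg]
      ext m
      rw [symbolPerm_apply, swap_apply_of_ne_of_ne (h3 m) (h4 m)]
    · rw [map_mul]
      change symbolPerm n k _ u = t'
      ext m
      by_cases hm : m = i'
      · rw [hm, symbolPerm_apply, swap_apply_left]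
      · rw [symbolPerm_apply, ← hu.2 m hm, swap_apply_of_ne_of_ne (h3 m) (h4 m), h'.2 m hm]
  obtain ⟨g, q, rfl, rfl⟩ := key h h'
  exact (card_avoiding_eq (disagree_symbolPerm_mul_coordPerm g q) s t).symm

/-- If the images were not close, some `u` close to `f s` would have a larger count. Pulled back by
`f`, this would give a pair at `s` exceeding the maximum, which close pairs attain. -/
theorem diffOne_of_disagree {n k : ℕ} (hkn : k < n) {f : Perm (Tuples n k)}
    (hf : ∀ s t, (∀ i, f s i ≠ f t i) ↔ ∀ i, s i ≠ t i) {s t : Tuples n k} (h : DiffOne s t) :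
    DiffOne (f s) (f t) := by
  by_contra hn
  obtain ⟨u, hu, hlt⟩ := exists_card_avoiding_lt hkn (f.injective.ne h.ne) hn
  have hf' : ∀ s t, (∀ i, f.symm s i ≠ f.symm t i) ↔ ∀ i, s i ≠ t i := fun s t => by
    rw [← hf]; simp
  by_cases hback : DiffOne s (f.symm u)
  · rw [card_avoiding_eq hf, card_avoiding_of_diffOne h hback, ← card_avoiding_eq hf,
      apply_symm_apply] at hlt
    exact lt_irrefl _ hlt
  · have hne : s ≠ f.symm u := by
      intro e
      rw [e, apply_symm_apply] at hu
      exact hu.ne rfl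
    obtain ⟨v, hv, hlt'⟩ := exists_card_avoiding_lt hkn hne hback
    rw [card_avoiding_eq hf, card_avoiding_of_diffOne h hv] at hlt
    have := card_avoiding_eq hf s (f.symm u)
    rw [apply_symm_apply] at this
    omega

theorem exists_eq_of_disagree {n k : ℕ} (hk : 1 ≤ k) (hkn : k < n) {f : Perm (Tuples n k)}
    (hf : ∀ s t, (∀ i, f s i ≠ f t i) ↔ ∀ i, s i ≠ t i) :
    ∃ g q, f = symbolPerm n k g * coordPerm n k q := by
  refine exists_eq_of_diffOne hk hkn fun s t => ⟨fun h => ?_, diffOne_of_disagree hkn hf⟩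
  have := diffOne_of_disagree (f := f.symm) hkn (fun s t => by rw [← hf]; simp) h
  simpa using this

/-! ### Derangements meeting a permutation; transpositions as minimisers -/

theorem exists_perm_apply_eq_three {n : ℕ} {a b c a' b' c' : Fin n} (hab : a ≠ b) (hac : a ≠ c)
    (hbc : b ≠ c) (hab' : a' ≠ b') (hac' : a' ≠ c') (hbc' : b' ≠ c') :
    ∃ σ : Perm (Fin n), σ a = a' ∧ σ b = b' ∧ σ c = c' := by
  have key : ∀ {a b c : Fin n}, a ≠ b → a ≠ c → b ≠ c → Function.Injective ![a, b, c] := by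
    intro a b c h1 h2 h3 i j h
    fin_cases i <;> fin_cases j <;> simp_all
  let s : Tuples n 3 := ⟨![a, b, c], key hab hac hbc⟩
  let t : Tuples n 3 := ⟨![a', b', c'], key hab' hac' hbc'⟩
  obtain ⟨σ, hσ⟩ := exists_symbolPerm_eq s t
  exact ⟨σ, DFunLike.congr_fun hσ 0, DFunLike.congr_fun hσ 1, DFunLike.congr_fun hσ 2⟩

/-- A conjugate of the full cycle; `4 ≤ n` keeps the chain from closing up after three steps. -/
theorem exists_derangement_chain {n : ℕ} (hn : 4 ≤ n) {a b c : Fin n} (hab : a ≠ b) (hac : a ≠ c)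
    (hbc : b ≠ c) :
    ∃ x : Perm (Fin n), (∀ m, x m ≠ m) ∧ x a = b ∧ x b = c ∧ x c ≠ a := by
  obtain ⟨m, rfl⟩ : ∃ m, n = m + 1 := ⟨n - 1, by omega⟩
  let r := finRotate (m + 1)
  have h0 : r ⟨0, by omega⟩ = ⟨1, by omega⟩ := finRotate_of_lt (by omega)
  have h1 : r ⟨1, by omega⟩ = ⟨2, by omega⟩ := finRotate_of_lt (by omega)
  have h2 : r ⟨2, by omega⟩ = ⟨3, by omega⟩ := finRotate_of_lt (by omega)
  obtain ⟨σ, ha, hb, hc⟩ := exists_perm_apply_eq_three hab hac hbc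
    (a' := (⟨0, by omega⟩ : Fin (m + 1))) (b' := ⟨1, by omega⟩) (c' := ⟨2, by omega⟩)
    (by simp) (by simp) (by simp)
  refine ⟨σ⁻¹ * r * σ, fun m e => ?_, ?_, ?_, ?_⟩
  · simp only [Perm.mul_apply, Perm.inv_eq_iff_eq] at e
    exact finRotate_ne (by omega) _ e
  · simp only [Perm.mul_apply, Perm.inv_eq_iff_eq, ha, hb, h0]
  · simp only [Perm.mul_apply, Perm.inv_eq_iff_eq, hb, hc, h1]
  · simp only [Perm.mul_apply, ne_eq, Perm.inv_eq_iff_eq, hc, ha, h2]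
    simp

/-- The derangements that agree with `π` somewhere. -/
def meeting {n : ℕ} (π : Perm (Fin n)) : Finset (Perm (Fin n)) :=
  Finset.univ.filter fun x => (∀ i, x i ≠ i) ∧ ∃ i, x i = π i

theorem mem_meeting {n : ℕ} {π x : Perm (Fin n)} :
    x ∈ meeting π ↔ (∀ i, x i ≠ i) ∧ ∃ i, x i = π i := by simp [meeting]

theorem mem_meeting_swap {n : ℕ} {i j : Fin n} {x : Perm (Fin n)} :
    x ∈ meeting (swap i j) ↔ (∀ i, x i ≠ i) ∧ (x i = j ∨ x j = i) := by
  rw [mem_meeting]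
  refine and_congr_right fun h => ⟨?_, ?_⟩
  · rintro ⟨m, hm⟩
    have := h m
    rw [swap_apply_def] at hm
    split_ifs at hm with h1 h2
    · left; rw [← h1, hm]
    · right; rw [← h2, hm]
    · exact absurd hm this
  · rintro (h | h)
    · exact ⟨i, by rw [h, swap_apply_left]⟩
    · exact ⟨j, by rw [h, swap_apply_right]⟩

theorem four_le_of_distinct {n : ℕ} {a b c d : Fin n} (hab : a ≠ b) (hac : a ≠ c) (had : a ≠ d)
    (hbc : b ≠ c) (hbd : b ≠ d) (hcd : c ≠ d) : 4 ≤ n := by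
  have h : ({a, b, c, d} : Finset (Fin n)).card = 4 := by
    rw [Finset.card_insert_of_notMem, Finset.card_insert_of_notMem, Finset.card_pair hcd] <;>
      simp [*]
  have := Finset.card_le_univ ({a, b, c, d} : Finset (Fin n))
  rw [h, Fintype.card_fin] at this
  exact this

theorem conj_derangement {n : ℕ} (σ : Perm (Fin n)) {x : Perm (Fin n)} (h : ∀ i, x i ≠ i) (i) :
    (σ * x * σ⁻¹) i ≠ i := by
  intro e
  rw [Perm.mul_apply, Perm.mul_apply, ← Perm.eq_inv_iff_eq] at e
  exact h _ e

theorem conj_apply_eq {n : ℕ} {σ x : Perm (Fin n)} {a b a' b' : Fin n} (ha : σ a = a')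
    (hb : σ b = b') (h : x a = b) : (σ * x * σ⁻¹) a' = b' := by
  subst ha hb h
  simp [Perm.mul_apply]

/-- Here `i`, `j`, `k` are consecutive on a cycle of length at least 3. Derangements with `x i = j`
count on both sides. Those with `x j = i` must be traded injectively, and not surjectively, for
others that meet `π`. -/
theorem card_meeting_swap_lt_of_long {n : ℕ} {π : Perm (Fin n)} {i m : Fin n} (hm : π m = m)
    (hi : π i ≠ i) (hi2 : π (π i) ≠ i) :
    (meeting (swap i (π i))).card < (meeting π).card := by
  obtain ⟨j, hj⟩ : ∃ j, π i = j := ⟨_, rfl⟩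
  obtain ⟨k, hk⟩ : ∃ k, π j = k := ⟨_, rfl⟩
  obtain ⟨l, hl⟩ : ∃ l, π k = l := ⟨_, rfl⟩
  rw [hj] at hi hi2
  rw [hj]
  rw [hk] at hi2
  have hij : i ≠ j := hi.symm
  have hik : i ≠ k := hi2.symm
  have hjk : j ≠ k := by
    rintro rfl; exact hij (π.injective (hj.trans hk.symm))
  have hmi : i ≠ m := by rintro rfl; exact hij (hm.symm.trans hj)
  have hmj : j ≠ m := by rintro rfl; exact hjk (hm.symm.trans hk)
  have hmk : k ≠ m := by rintro rfl; exact hjk (π.injective (hk.trans hm.symm))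
  have hkl : k ≠ l := by
    rintro rfl; exact hjk (π.injective (hk.trans hl.symm))
  have hn : 4 ≤ n := four_le_of_distinct hij hik hmi hjk hmj hmk
  let D : Finset (Perm (Fin n)) := Finset.univ.filter fun x => ∀ i, x i ≠ i
  have hD : ∀ x, x ∈ D ↔ ∀ i, x i ≠ i := fun x => by simp [D]
  -- `A`, `B₁`, `B₂` cover the meetings with the transposition, while `A`, `C`, `U` are disjoint
  -- parts of the meetings with `π`. Left multiplication by `swap i k` carries `B₁` into `C`, and a
  -- conjugation carries `B₂` properly into `U`.
  let A := D.filter fun x => x i = j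
  let B₁ := D.filter fun x => x j = i ∧ x i ≠ j ∧ x i ≠ k
  let B₂ := D.filter fun x => x j = i ∧ x i = k
  let C := D.filter fun x => x j = k ∧ x i ≠ j ∧ x k ≠ i
  let U := D.filter fun x => x i ≠ j ∧ ¬ (x j = k ∧ x k ≠ i) ∧ ∃ i, x i = π i
  have hA : ∀ x, x ∈ A ↔ (∀ i, x i ≠ i) ∧ x i = j := fun x => by simp [A, hD]
  have hB₁ : ∀ x, x ∈ B₁ ↔ (∀ i, x i ≠ i) ∧ x j = i ∧ x i ≠ j ∧ x i ≠ k :=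
    fun x => by simp [B₁, hD]
  have hB₂ : ∀ x, x ∈ B₂ ↔ (∀ i, x i ≠ i) ∧ x j = i ∧ x i = k := fun x => by simp [B₂, hD]
  have hC : ∀ x, x ∈ C ↔ (∀ i, x i ≠ i) ∧ x j = k ∧ x i ≠ j ∧ x k ≠ i :=
    fun x => by simp [C, hD]
  have hU : ∀ x, x ∈ U ↔ (∀ i, x i ≠ i) ∧ x i ≠ j ∧ ¬ (x j = k ∧ x k ≠ i) ∧ ∃ i, x i = π i :=
    fun x => by simp only [U, Finset.mem_filter, hD]
  have hle : (meeting (swap i j)).card ≤ A.card + B₁.card + B₂.card := by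
    refine le_trans (Finset.card_le_card fun x hx => ?_)
      ((Finset.card_union_le (A ∪ B₁) B₂).trans (Nat.add_le_add_right (Finset.card_union_le _ _) _))
    rw [mem_meeting_swap] at hx
    simp only [Finset.mem_union, hA, hB₁, hB₂]
    obtain ⟨h1, h2⟩ := hx
    by_cases h3 : x i = j <;> by_cases h4 : x i = k <;> tauto
  have hge : A.card + C.card + U.card ≤ (meeting π).card := by
    have d1 : Disjoint A C := Finset.disjoint_left.2 fun x hx hx' =>
      ((hC x).1 hx').2.2.1 ((hA x).1 hx).2
    have d2 : Disjoint (A ∪ C) U := by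
      refine Finset.disjoint_left.2 fun x hx hx' => ?_
      obtain ⟨-, h1, h2, -⟩ := (hU x).1 hx'
      rcases Finset.mem_union.1 hx with hx | hx
      · exact h1 ((hA x).1 hx).2
      · exact h2 ⟨((hC x).1 hx).2.1, ((hC x).1 hx).2.2.2⟩
    rw [← Finset.card_union_of_disjoint d1, ← Finset.card_union_of_disjoint d2]
    refine Finset.card_le_card fun x hx => ?_
    simp only [Finset.mem_union, hA, hC, hU] at hx
    rw [mem_meeting]
    rcases hx with (⟨h, h'⟩ | ⟨h, h', -⟩) | ⟨h, -, -, h'⟩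
    · exact ⟨h, i, by rw [h', hj]⟩
    · exact ⟨h, j, by rw [h', hk]⟩
    · exact ⟨h, h'⟩
  have hBC : B₁.card ≤ C.card := by
    refine Finset.card_le_card_of_injOn (fun x => swap i k * x) (fun x hx => ?_)
      (mul_right_injective _).injOn
    obtain ⟨h, h1, h2, h3⟩ := (hB₁ x).1 hx
    refine (hC _).2 ⟨fun p e => ?_, ?_, fun e => ?_, fun e => ?_⟩
    · rw [Perm.mul_apply, swap_apply_def] at e
      have := h p
      split_ifs at e with h4 h5
      · rw [← e] at h4
        exact hjk (x.injective (h1.trans h4.symm))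
      · rw [← e] at h5
        exact h3 h5
      · exact this e
    · rw [Perm.mul_apply, h1, swap_apply_left]
    · rw [Perm.mul_apply, swap_apply_of_ne_of_ne (h i) h3] at e
      exact h2 e
    · rw [Perm.mul_apply, swap_apply_eq_iff, swap_apply_left] at e
      exact h k e
  have hBU : B₂.card < U.card := by
    -- Elements of `B₂` contain `j ↦ i ↦ k`. If the cycle closes (`l = i`), this is relabelled as `k
    -- ↦ i ↦ m` using the fixed point `m`; otherwise as `i ↦ k ↦ l`. In both cases the result agrees
    -- with `π` at `k`.
    by_cases hli : l = i
    · obtain ⟨σ, hσj, hσi, hσk⟩ := exists_perm_apply_eq_three hij.symm hjk hik hik.symm hmk hmi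
      rw [← Finset.card_map (MulAut.conj σ).toEquiv.toEmbedding]
      apply Finset.card_lt_card
      rw [Finset.ssubset_iff_of_subset]
      · obtain ⟨y, hy, hyj, hyk, hyi⟩ := exists_derangement_chain hn hjk hij.symm hik.symm
        have e1 : (y * swap i j) i = k := by simp [hyj]
        have e2 : (y * swap i j) j = y i := by simp
        have e3 : ∀ p, p ≠ i → p ≠ j → (y * swap i j) p = y p := fun p h1 h2 => by
          rw [Perm.mul_apply, swap_apply_of_ne_of_ne h1 h2]
        refine ⟨y * swap i j, (hU _).2 ⟨fun p => ?_, ?_, ?_, k, ?_⟩, ?_⟩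
        · by_cases hp : p = i
          · rw [hp, e1]; exact hik.symm
          · by_cases hp' : p = j
            · rw [hp', e2]; exact hyi
            · rw [e3 p hp hp']; exact hy p
        · rw [e1]; exact hjk.symm
        · rw [e3 k hik.symm hjk.symm, hyk]; simp
        · rw [e3 k hik.symm hjk.symm, hyk, hl, hli]
        · rw [Finset.mem_map]
          rintro ⟨x, hx, hxy⟩
          obtain ⟨h, h1, h2⟩ := (hB₂ x).1 hx
          have h3 : (σ * x * σ⁻¹) i = m := conj_apply_eq hσi hσk h2
          have h4 : (σ * x * σ⁻¹) i = k := by rw [← e1]; exact DFunLike.congr_fun hxy i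
          exact hmk (h4.symm.trans h3)
      · intro z hz
        obtain ⟨x, hx, rfl⟩ := Finset.mem_map.1 hz
        obtain ⟨h, h1, h2⟩ := (hB₂ x).1 hx
        have h3 : (σ * x * σ⁻¹) i = m := conj_apply_eq hσi hσk h2
        have h4 : (σ * x * σ⁻¹) k = i := conj_apply_eq hσj hσi h1
        refine (hU _).2 ⟨conj_derangement σ h, ?_, ?_, k, ?_⟩
        · exact fun e => hmj (e.symm.trans h3)
        · exact fun e => e.2 h4
        · rw [hl, hli]; exact h4
    · obtain ⟨σ, hσj, hσi, hσk⟩ := exists_perm_apply_eq_three hij.symm hjk hik hik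
        (Ne.symm hli) hkl
      rw [← Finset.card_map (MulAut.conj σ).toEquiv.toEmbedding]
      apply Finset.card_lt_card
      rw [Finset.ssubset_iff_of_subset]
      · obtain ⟨y, hy, hyj, hyk, hyi⟩ := exists_derangement_chain hn hjk hij.symm hik.symm
        refine ⟨y, (hU _).2 ⟨hy, hyi, fun e => e.2 hyk, j, by rw [hyj, hk]⟩, ?_⟩
        rw [Finset.mem_map]
        rintro ⟨x, hx, rfl⟩
        obtain ⟨h, h1, h2⟩ := (hB₂ x).1 hx
        have h3 : (σ * x * σ⁻¹) i = k := conj_apply_eq hσj hσi h1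
        exact hij ((σ * x * σ⁻¹).injective (h3.trans hyj.symm))
      · intro z hz
        obtain ⟨x, hx, rfl⟩ := Finset.mem_map.1 hz
        obtain ⟨h, h1, h2⟩ := (hB₂ x).1 hx
        have h3 : (σ * x * σ⁻¹) i = k := conj_apply_eq hσj hσi h1
        have h4 : (σ * x * σ⁻¹) k = l := conj_apply_eq hσi hσk h2
        refine (hU _).2 ⟨conj_derangement σ h, ?_, ?_, k, ?_⟩
        · exact fun e => hjk (e.symm.trans h3)
        · exact fun e => hij ((σ * x * σ⁻¹).injective (h3.trans e.1.symm))
        · rw [hl]; exact h4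
  omega

/-- The two-cycle through `i` belongs to `π`, so there is an inclusion of meeting sets. It is strict
because a second two-cycle `k`, `l` can be met while avoiding the first. -/
theorem card_meeting_swap_lt_of_involutive {n : ℕ} {π : Perm (Fin n)} {i m : Fin n} (hm : π m = m)
    (hi : π i ≠ i) (h2 : ∀ a, π (π a) = a) (hs : ¬ π.IsSwap) :
    (meeting (swap i (π i))).card < (meeting π).card := by
  obtain ⟨j, hj⟩ : ∃ j, π i = j := ⟨_, rfl⟩
  have hji : π j = i := by rw [← hj, h2]
  rw [hj] at hi ⊢
  obtain ⟨k, hk⟩ : ∃ k, π k ≠ swap i j k := by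
    by_contra! h
    exact hs ⟨i, j, hi.symm, Equiv.ext h⟩
  have hki : k ≠ i := by rintro rfl; rw [swap_apply_left] at hk; exact hk hj
  have hkj : k ≠ j := by rintro rfl; rw [swap_apply_right] at hk; exact hk hji
  rw [swap_apply_of_ne_of_ne hki hkj] at hk
  obtain ⟨l, hl⟩ : ∃ l, π k = l := ⟨_, rfl⟩
  rw [hl] at hk
  have hli : l ≠ i := by rintro rfl; exact hkj (π.injective (hl.trans hji.symm))
  have hlj : l ≠ j := by rintro rfl; exact hki (π.injective (hl.trans hj.symm))
  have hmi : m ≠ i := by rintro rfl; exact hi (hj.symm.trans hm)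
  have hmj : m ≠ j := by rintro rfl; exact hi (hm.symm.trans hji)
  have hmk : m ≠ k := by rintro rfl; exact hk (hl.symm.trans hm)
  have hml : m ≠ l := by
    rintro rfl; exact hk (by rw [← hm, ← hl, h2])
  have hn : 4 ≤ n := four_le_of_distinct hi hkj.symm hmj.symm hki.symm hmi.symm hmk.symm
  apply Finset.card_lt_card
  rw [Finset.ssubset_iff_of_subset]
  · suffices h : ∃ x : Perm (Fin n), (∀ p, x p ≠ p) ∧ x k = l ∧ x i ≠ j ∧ x j ≠ i by
      obtain ⟨x, hx, h1, h3, h4⟩ := h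
      refine ⟨x, mem_meeting.2 ⟨hx, k, by rw [h1, hl]⟩, fun h => ?_⟩
      rcases (mem_meeting_swap.1 h).2 with h | h
      · exact h3 h
      · exact h4 h
    obtain ⟨x, hx, hxi, hxk, -⟩ := exists_derangement_chain hn hki.symm hli.symm hk.symm
    -- If the chain `i ↦ k ↦ l` is preceded by `j`, conjugating by `swap j m` puts the fixed point
    -- `m` of `π` in that place and leaves the chain intact.
    by_cases hxj : x j = i
    · have e : ∀ p, p ≠ j → p ≠ m → swap j m p = p := fun p => swap_apply_of_ne_of_ne
      have ei := e i hi.symm hmi.symm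
      refine ⟨swap j m * x * (swap j m)⁻¹, conj_derangement _ hx,
        conj_apply_eq (e k hkj hmk.symm) (e l hlj hml.symm) hxk, ?_, ?_⟩
      · rw [conj_apply_eq ei (e k hkj hmk.symm) hxi]; exact hkj
      · intro h
        have := conj_apply_eq (swap_apply_left j m) ei hxj
        exact hmj ((swap j m * x * (swap j m)⁻¹).injective (this.trans h.symm))
    · exact ⟨x, hx, hxk, by rw [hxi]; exact hkj, hxj⟩
  · intro x hx
    obtain ⟨h, h'⟩ := mem_meeting_swap.1 hx
    refine mem_meeting.2 ⟨h, ?_⟩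
    rcases h' with h' | h'
    · exact ⟨i, by rw [h', hj]⟩
    · exact ⟨j, by rw [h', hji]⟩

theorem card_meeting_conj {n : ℕ} (σ π : Perm (Fin n)) :
    (meeting (σ * π * σ⁻¹)).card = (meeting π).card := by
  symm
  refine Finset.card_equiv (MulAut.conj σ).toEquiv fun x => ?_
  change _ ↔ σ * x * σ⁻¹ ∈ _
  simp only [mem_meeting]
  refine and_congr ⟨conj_derangement σ, fun h => ?_⟩ ?_
  · have := conj_derangement σ⁻¹ h
    simpa [mul_assoc] using this
  · rw [← σ.exists_congr_right (q := fun i => (σ * x * σ⁻¹) i = (σ * π * σ⁻¹) i)]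
    simp [Perm.mul_apply]

/-- The count is invariant under conjugation, so `τ` may be replaced by a transposition `swap i (π
i)` adapted to `π`. -/
theorem card_meeting_lt {n : ℕ} {π τ : Perm (Fin n)} {m : Fin n} (hm : π m = m) (h1 : π ≠ 1)
    (hs : ¬ π.IsSwap) (hτ : τ.IsSwap) : (meeting τ).card < (meeting π).card := by
  have key : ∃ i, π i ≠ i ∧ (meeting (swap i (π i))).card < (meeting π).card := by
    by_cases h : ∃ i, π i ≠ i ∧ π (π i) ≠ i
    · obtain ⟨i, hi, hi2⟩ := h
      exact ⟨i, hi, card_meeting_swap_lt_of_long hm hi hi2⟩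
    · push Not at h
      obtain ⟨i, hi⟩ : ∃ i, π i ≠ i := by
        by_contra! h'
        exact h1 (Equiv.ext h')
      refine ⟨i, hi, card_meeting_swap_lt_of_involutive hm hi (fun a => ?_) hs⟩
      by_cases ha : π a = a
      · rw [ha, ha]
      · exact h a ha
  obtain ⟨i, hi, hlt⟩ := key
  obtain ⟨σ, hσ⟩ := isConj_iff.1 (show IsConj τ (swap i (π i)) from by
    obtain ⟨a, b, hab, rfl⟩ := hτ
    exact Perm.isConj_swap hab hi.symm)
  rwa [← hσ, card_meeting_conj] at hlt

/-- The permutations that agree with neither `x` nor `y` anywhere. -/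
def permAvoiding {n : ℕ} (x y : Perm (Fin n)) : Finset (Perm (Fin n)) :=
  Finset.univ.filter fun z => (∀ i, z i ≠ x i) ∧ ∀ i, z i ≠ y i

/-- Left translation by `x⁻¹` moves the pair to `1` and `x⁻¹ * y`; the derangements then split
according to whether they meet `x⁻¹ * y`. -/
theorem card_permAvoiding_add {n : ℕ} (x y : Perm (Fin n)) :
    (permAvoiding x y).card + (meeting (x⁻¹ * y)).card =
      (Finset.univ.filter fun z : Perm (Fin n) => ∀ i, z i ≠ i).card := by
  have h : (permAvoiding x y).card =
      ((Finset.univ.filter fun z : Perm (Fin n) => ∀ i, z i ≠ i).filter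
        fun z => ¬ ∃ i, z i = (x⁻¹ * y) i).card := by
    refine Finset.card_equiv (Equiv.mulLeft x⁻¹) fun z => ?_
    simp only [permAvoiding, Finset.mem_filter, Finset.mem_univ, true_and, coe_mulLeft,
      Perm.mul_apply, not_exists, EmbeddingLike.apply_eq_iff_eq, ne_eq, Perm.inv_eq_iff_eq]
  rw [h, meeting, ← Finset.filter_filter, add_comm]
  exact Finset.card_filter_add_card_filter_not _

/-- Since `2 < n`, a transposition has a fixed point, so `x` and `y` agree somewhere and so do their
images. A quotient of the images that is not a transposition would be met by strictly more
derangements, contradicting the equality of common-neighbour counts. -/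
theorem isSwap_of_disagree {n : ℕ} (hn : 2 < n) {F : Perm (Perm (Fin n))}
    (hF : ∀ x y, (∀ i, F x i ≠ F y i) ↔ ∀ i, x i ≠ y i) {x y : Perm (Fin n)}
    (h : (x⁻¹ * y).IsSwap) : ((F x)⁻¹ * F y).IsSwap := by
  by_contra hs
  obtain ⟨i, j, hij, hxy⟩ := h
  obtain ⟨m, hm⟩ : ∃ m : Fin n, m ∉ ({i, j} : Finset (Fin n)) := by
    by_contra! h
    have h1 : (Finset.univ : Finset (Fin n)) ⊆ {i, j} := fun m _ => h m
    have h2 := Finset.card_le_card h1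
    rw [Finset.card_pair hij, Finset.card_univ, Fintype.card_fin] at h2
    omega
  simp only [Finset.mem_insert, Finset.mem_singleton, not_or] at hm
  have hag : ¬ ∀ i, x i ≠ y i := by
    push Not
    refine ⟨m, ?_⟩
    rw [show y = x * swap i j by rw [← hxy, mul_inv_cancel_left], Perm.mul_apply,
      swap_apply_of_ne_of_ne hm.1 hm.2]
  rw [← hF] at hag
  push Not at hag
  obtain ⟨p, hp⟩ := hag
  have hne : x ≠ y := by
    rintro rfl
    rw [inv_mul_cancel] at hxy
    have := DFunLike.congr_fun hxy i
    rw [swap_apply_left] at this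
    exact hij this
  have hlt := card_meeting_lt (τ := x⁻¹ * y) (π := (F x)⁻¹ * F y) (m := p)
    (by rw [Perm.mul_apply, Perm.inv_eq_iff_eq, hp])
    (fun e => hne (F.injective (inv_mul_eq_one.1 e))) hs ⟨i, j, hij, hxy⟩
  have heq : (permAvoiding x y).card = (permAvoiding (F x) (F y)).card := by
    refine Finset.card_equiv F fun z => ?_
    simp only [permAvoiding, Finset.mem_filter, Finset.mem_univ, true_and, hF]
  have e1 := card_permAvoiding_add x y
  have e2 := card_permAvoiding_add (F x) (F y)
  omega

/-! ### The transposition Cayley graph: common neighbours and 3-cycles -/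

section Transpositions

variable {α : Type*} [DecidableEq α]

theorem Equiv.Perm.IsSwap.eq_swap {z : Perm α} (hz : z.IsSwap) {a b : α} (h : z a = b)
    (hab : a ≠ b) : z = swap a b := by
  obtain ⟨x, y, -, rfl⟩ := hz
  rw [swap_apply_def] at h
  split_ifs at h with h1 h2
  · rw [h1, ← h]
  · rw [h2, ← h, swap_comm]
  · exact absurd h hab

theorem Equiv.Perm.IsSwap.mul_swap_apply_ne {z : Perm α} (hz : z.IsSwap) {p q : α} (hpq : p ≠ q)
    (h : z * swap p q ≠ 1) : (z * swap p q) p ≠ p ∧ (z * swap p q) q ≠ q := by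
  constructor <;> intro e <;> apply h
  · rw [Perm.mul_apply, swap_apply_left] at e
    rw [hz.eq_swap e hpq.symm, swap_comm, swap_mul_self]
  · rw [Perm.mul_apply, swap_apply_right] at e
    rw [hz.eq_swap e hpq, swap_mul_self]

/-- If `ρ⁻¹ * swap p q` is a transposition, then `ρ` moves `p` and `q`. -/
theorem apply_ne_of_isSwap_inv_mul {ρ : Perm α} {p q : α} (hpq : p ≠ q) (hρ : ρ ≠ 1)
    (h : (ρ⁻¹ * swap p q).IsSwap) : ρ p ≠ p ∧ ρ q ≠ q := by
  have := h.mul_swap_apply_ne hpq (by simpa [mul_assoc] using hρ)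
  rw [mul_assoc, swap_mul_self, mul_one] at this
  exact ⟨fun e => this.1 (by rw [Perm.inv_eq_iff_eq, e]),
    fun e => this.2 (by rw [Perm.inv_eq_iff_eq, e])⟩

/-- The `3`-cycle `a ↦ b ↦ c ↦ a`. -/
def threeCycle (a b c : α) : Perm α := swap a b * swap b c

theorem threeCycle_rotate {a b c : α} (hab : a ≠ b) (hac : a ≠ c) (hbc : b ≠ c) :
    threeCycle b c a = threeCycle a b c := by
  ext x
  simp only [threeCycle, Perm.mul_apply, swap_apply_def]
  grind

theorem threeCycle_inv (a b c : α) : (threeCycle a b c)⁻¹ = threeCycle c b a := by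
  rw [threeCycle, threeCycle, mul_inv_rev, swap_inv, swap_inv, swap_comm b c, swap_comm a b]

theorem threeCycle_ne_one {a b c : α} (hab : a ≠ b) (hac : a ≠ c) : threeCycle a b c ≠ 1 := by
  intro h
  have := DFunLike.congr_fun h a
  rw [threeCycle, Perm.mul_apply, swap_apply_of_ne_of_ne hab hac, swap_apply_left] at this
  exact hab this.symm

/-- Both points of such an `s` are moved by the 3-cycle (`apply_ne_of_isSwap_inv_mul`), which leaves
only the three transpositions inside its support. -/
theorem isSwap_threeCycle_inv_mul_iff {a b c : α} (hab : a ≠ b) (hac : a ≠ c) (hbc : b ≠ c)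
    {s : Perm α} (hs : s.IsSwap) :
    ((threeCycle a b c)⁻¹ * s).IsSwap ↔ s = swap a b ∨ s = swap b c ∨ s = swap a c := by
  constructor
  · obtain ⟨p, q, hpq, rfl⟩ := hs
    intro h
    obtain ⟨h1, h2⟩ := apply_ne_of_isSwap_inv_mul hpq (threeCycle_ne_one hab hac) h
    have key : ∀ x, threeCycle a b c x ≠ x → x = a ∨ x = b ∨ x = c := by
      intro x hx
      by_contra! h
      exact hx (by rw [threeCycle, Perm.mul_apply, swap_apply_of_ne_of_ne h.2.1 h.2.2,
        swap_apply_of_ne_of_ne h.1 h.2.1])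
    rcases key p h1 with rfl | rfl | rfl <;> rcases key q h2 with rfl | rfl | rfl <;>
      simp [swap_comm] at hpq ⊢
  · have e : (threeCycle a b c)⁻¹ = swap b c * swap a b := by simp [threeCycle]
    rintro (rfl | rfl | rfl)
    · rw [e, mul_assoc, swap_mul_self, mul_one]; exact ⟨b, c, hbc, rfl⟩
    · rw [← threeCycle_rotate hab hac hbc]
      simp only [threeCycle, mul_inv_rev, swap_inv, mul_assoc, swap_mul_self, mul_one]
      exact ⟨c, a, hac.symm, rfl⟩
    · rw [e]
      refine ⟨a, b, hab, ?_⟩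
      ext x
      simp only [Perm.mul_apply, swap_apply_def]
      grind

theorem isSwap_swap_mul_swap_inv_mul {a b c d : α} (hab : a ≠ b) (hac : a ≠ c) (had : a ≠ d)
    (hbc : b ≠ c) (hbd : b ≠ d) (hcd : c ≠ d) {s : Perm α} (hs : s.IsSwap)
    (h : ((swap a b * swap c d)⁻¹ * s).IsSwap) : s = swap a b ∨ s = swap c d := by
  obtain ⟨p, q, hpq, rfl⟩ := hs
  set ρ := swap a b * swap c d with hρ
  have ha : ρ a = b := by simp [hρ, swap_apply_of_ne_of_ne hac had]
  have hb : ρ b = a := by simp [hρ, swap_apply_of_ne_of_ne hbc hbd]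
  have hc : ρ c = d := by simp [hρ, swap_apply_of_ne_of_ne had.symm hbd.symm]
  have hd : ρ d = c := by simp [hρ, swap_apply_of_ne_of_ne hac.symm hbc.symm]
  have hinv : ρ⁻¹ = ρ := by
    ext x
    rw [Perm.inv_eq_iff_eq]
    simp only [hρ, Perm.mul_apply, swap_apply_def]
    grind
  have hne : ρ ≠ 1 := fun h => hab (by rw [← ha, h]; rfl)
  obtain ⟨h1, h2⟩ := apply_ne_of_isSwap_inv_mul hpq hne h
  have key : ∀ x, ρ x ≠ x → x = a ∨ x = b ∨ x = c ∨ x = d := by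
    intro x hx
    by_contra! h
    exact hx (by rw [hρ, Perm.mul_apply, swap_apply_of_ne_of_ne h.2.2.1 h.2.2.2,
      swap_apply_of_ne_of_ne h.1 h.2.1])
  rw [hinv] at h
  -- Choosing one point from each two-cycle of `ρ` makes the product a 4-cycle: it sends `p' ↦ p ↦
  -- q'` with `p' ≠ q'`, which no transposition does.
  have bad : ∀ p p' q q' : α, ρ p = p' → ρ p' = p → ρ q = q' → p ≠ q → p' ≠ q → p ≠ q' → p ≠ p' →
      ¬ (ρ * swap p q).IsSwap := by
    intro p p' q q' e1 e2 e3 n1 n2 n3 n4 h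
    have i1 : (ρ * swap p q) p = q' := by rw [Perm.mul_apply, swap_apply_left, e3]
    have i2 : (ρ * swap p q) p' = p := by
      rw [Perm.mul_apply, swap_apply_of_ne_of_ne n4.symm n2, e2]
    have i3 := h.eq_swap i1 n3
    rw [i3, swap_apply_def] at i2
    have : p' ≠ q' := fun e => n1 (ρ.injective (e1.trans (e.trans e3.symm)))
    rw [if_neg n4.symm, if_neg this] at i2
    exact n4 i2.symm
  rcases key p h1 with rfl | rfl | rfl | rfl <;> rcases key q h2 with rfl | rfl | rfl | rfl <;>
    first
    | exact absurd rfl hpq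
    | exact Or.inl rfl
    | exact Or.inr rfl
    | exact Or.inl (swap_comm _ _)
    | exact Or.inr (swap_comm _ _)
    | (refine absurd h (bad _ _ _ _ ‹_› ‹_› ‹_› ?_ ?_ ?_ ?_) <;> first | assumption | (apply Ne.symm; assumption))

end Transpositions

section Transpositions

variable {α : Type*} [DecidableEq α]

theorem isSwap_inv {z : Perm α} (hz : z.IsSwap) : z⁻¹.IsSwap := by
  obtain ⟨a, b, hab, rfl⟩ := hz
  exact ⟨a, b, hab, swap_inv a b⟩

theorem isSwap_inv_mul_comm {x y : Perm α} (h : (x⁻¹ * y).IsSwap) : (y⁻¹ * x).IsSwap := by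
  have := isSwap_inv h
  rwa [mul_inv_rev, inv_inv] at this

/-- Writing `w = swap a b * t` makes `t` a transposition adjacent to a 3-cycle, so there are three
choices. Disjoint transpositions have only two common neighbours, and this difference drives the
later arguments. -/
theorem eq_of_isSwap_inv_mul_of_sharing {a b c : α} (hab : a ≠ b) (hac : a ≠ c) (hbc : b ≠ c)
    {w : Perm α} (h1 : (w⁻¹ * swap a b).IsSwap) (h2 : (w⁻¹ * swap b c).IsSwap) :
    w = 1 ∨ w = threeCycle a b c ∨ w = threeCycle c b a := by
  obtain ⟨t, rfl⟩ : ∃ t, w = swap a b * t := ⟨swap a b * w, by rw [← mul_assoc]; simp⟩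
  have ht : t.IsSwap := by
    have := isSwap_inv_mul_comm h1
    rwa [swap_inv, ← mul_assoc, swap_mul_self, one_mul] at this
  have h3 : ((threeCycle a b c)⁻¹ * t).IsSwap := by
    have := isSwap_inv_mul_comm h2
    rwa [← mul_assoc, show (swap b c)⁻¹ * swap a b = (threeCycle a b c)⁻¹ by
      simp [threeCycle]] at this
  rcases (isSwap_threeCycle_inv_mul_iff hab hac hbc ht).1 h3 with rfl | rfl | rfl
  · left; exact swap_mul_self a b
  · right; left; rfl
  · right; right
    ext x
    simp only [threeCycle, Perm.mul_apply, swap_apply_def]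
    grind

theorem eq_of_isSwap_inv_mul_of_disjoint {a b c d : α} (hab : a ≠ b) (hac : a ≠ c) (had : a ≠ d)
    (hbc : b ≠ c) (hbd : b ≠ d) (hcd : c ≠ d) {w : Perm α} (h1 : (w⁻¹ * swap a b).IsSwap)
    (h2 : (w⁻¹ * swap c d).IsSwap) : w = 1 ∨ w = swap a b * swap c d := by
  obtain ⟨t, rfl⟩ : ∃ t, w = swap a b * t := ⟨swap a b * w, by rw [← mul_assoc]; simp⟩
  have ht : t.IsSwap := by
    have := isSwap_inv_mul_comm h1
    rwa [swap_inv, ← mul_assoc, swap_mul_self, one_mul] at this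
  have h3 : ((swap a b * swap c d)⁻¹ * t).IsSwap := by
    have := isSwap_inv_mul_comm h2
    rwa [← mul_assoc, show (swap c d)⁻¹ * swap a b = (swap a b * swap c d)⁻¹ by simp] at this
  rcases isSwap_swap_mul_swap_inv_mul hab hac had hbc hbd hcd ht h3 with rfl | rfl
  · left; exact swap_mul_self a b
  · right; rfl

/-- The bijection `F` of `Perm α` is an automorphism of the transposition Cayley graph. -/
def PresSwap (F : Perm (Perm α)) : Prop :=
  ∀ x y, ((F x)⁻¹ * F y).IsSwap ↔ (x⁻¹ * y).IsSwap

/-- `F` fixes the identity and every transposition. -/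
def FixesSwaps (F : Perm (Perm α)) : Prop :=
  F 1 = 1 ∧ ∀ a b, a ≠ b → F (swap a b) = swap a b

theorem PresSwap.apply_threeCycle {F : Perm (Perm α)} (hF : PresSwap F) (hfix : FixesSwaps F)
    {a b c : α} (hab : a ≠ b) (hac : a ≠ c) (hbc : b ≠ c) :
    F (threeCycle a b c) = threeCycle a b c ∨ F (threeCycle a b c) = threeCycle c b a := by
  have h1 : ((F (threeCycle a b c))⁻¹ * swap a b).IsSwap := by
    rw [← hfix.2 a b hab, hF, isSwap_threeCycle_inv_mul_iff hab hac hbc ⟨a, b, hab, rfl⟩]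
    exact Or.inl rfl
  have h2 : ((F (threeCycle a b c))⁻¹ * swap b c).IsSwap := by
    rw [← hfix.2 b c hbc, hF, isSwap_threeCycle_inv_mul_iff hab hac hbc ⟨b, c, hbc, rfl⟩]
    exact Or.inr (Or.inl rfl)
  refine (eq_of_isSwap_inv_mul_of_sharing hab hac hbc h1 h2).resolve_left fun h => ?_
  rw [← hfix.1] at h
  exact threeCycle_ne_one hab hac (F.injective h)

/-- If one 3-cycle were fixed and the other inverted, two vertices with three common neighbours
would go to two vertices with at most two, because `(threeCycle a b c)⁻¹ * threeCycle d b a` is a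
product of disjoint transpositions. -/
theorem PresSwap.threeCycle_fixed_of_common_edge {F : Perm (Perm α)} (hF : PresSwap F)
    (hfix : FixesSwaps F) {a b c d : α} (hab : a ≠ b) (hac : a ≠ c) (had : a ≠ d) (hbc : b ≠ c)
    (hbd : b ≠ d) (hcd : c ≠ d) (h : F (threeCycle a b c) = threeCycle a b c) :
    F (threeCycle a b d) = threeCycle a b d := by
  refine (hF.apply_threeCycle hfix hab had hbd).resolve_right fun h' => ?_
  have e1 : (threeCycle a b c)⁻¹ * threeCycle a b d = threeCycle b d c := by
    rw [threeCycle_inv]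
    ext x
    simp only [threeCycle, Perm.mul_apply, swap_apply_def]
    grind
  have e2 : (threeCycle a b c)⁻¹ * threeCycle d b a = swap a d * swap b c := by
    rw [threeCycle_inv]
    ext x
    simp only [threeCycle, Perm.mul_apply, swap_apply_def]
    grind
  have key : ∀ s : Perm α, s = swap b d ∨ s = swap d c ∨ s = swap b c →
      (threeCycle a b c)⁻¹ * F (threeCycle a b c * s) = swap a d ∨
      (threeCycle a b c)⁻¹ * F (threeCycle a b c * s) = swap b c := by
    intro s hs
    have hsw : s.IsSwap := by
      rcases hs with rfl | rfl | rfl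
      exacts [⟨_, _, hbd, rfl⟩, ⟨_, _, hcd.symm, rfl⟩, ⟨_, _, hbc, rfl⟩]
    have h1 : ((threeCycle a b c)⁻¹ * F (threeCycle a b c * s)).IsSwap := by
      nth_rw 1 [← h]
      rw [hF, inv_mul_cancel_left]
      exact hsw
    refine isSwap_swap_mul_swap_inv_mul had hab hac hbd.symm hcd.symm hbc h1 ?_
    rw [← e2, mul_inv_rev, inv_inv, mul_assoc, mul_inv_cancel_left, ← h', hF]
    have := (isSwap_threeCycle_inv_mul_iff hbd hbc hcd.symm hsw).2 hs
    rwa [← e1, mul_inv_rev, inv_inv, mul_assoc] at this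
  have hinj : ∀ s t z, (threeCycle a b c)⁻¹ * F (threeCycle a b c * s) = z →
      (threeCycle a b c)⁻¹ * F (threeCycle a b c * t) = z → s = t := by
    intro s t z h1 h2
    exact mul_left_cancel (F.injective (mul_left_cancel (h1.trans h2.symm)))
  have n1 : swap b d ≠ swap d c := fun e => by
    have := DFunLike.congr_fun e b
    rw [swap_apply_left, swap_apply_of_ne_of_ne hbd hbc] at this
    exact hbd this.symm
  have n2 : swap b d ≠ swap b c := fun e => by
    have := DFunLike.congr_fun e b
    rw [swap_apply_left, swap_apply_left] at this
    exact hcd this.symm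
  have n3 : swap d c ≠ swap b c := fun e => by
    have := DFunLike.congr_fun e c
    rw [swap_apply_right, swap_apply_right] at this
    exact hbd this.symm
  rcases key _ (Or.inl rfl) with k1 | k1 <;> rcases key _ (Or.inr (Or.inl rfl)) with k2 | k2 <;>
    rcases key _ (Or.inr (Or.inr rfl)) with k3 | k3 <;>
    first
    | exact n1 (hinj _ _ _ k1 k2)
    | exact n2 (hinj _ _ _ k1 k3)
    | exact n3 (hinj _ _ _ k2 k3)

/-- Any triple of distinct points is reachable from any other by rotating, reversing and replacing
one entry, and each move preserves being fixed. -/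
theorem PresSwap.threeCycle_fixed {F : Perm (Perm α)} (hF : PresSwap F) (hfix : FixesSwaps F)
    {x y z : α} (hxy : x ≠ y) (hxz : x ≠ z) (hyz : y ≠ z)
    (h : F (threeCycle x y z) = threeCycle x y z) {a b c : α} (hab : a ≠ b) (hac : a ≠ c)
    (hbc : b ≠ c) : F (threeCycle a b c) = threeCycle a b c := by
  let P : α → α → α → Prop := fun a b c =>
    a ≠ b ∧ a ≠ c ∧ b ≠ c ∧ F (threeCycle a b c) = threeCycle a b c
  have rot : ∀ {a b c}, P a b c → P b c a := by
    rintro a b c ⟨h1, h2, h3, h4⟩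
    exact ⟨h3, h1.symm, h2.symm, by rwa [threeCycle_rotate h1 h2 h3]⟩
  have flip : ∀ {a b c}, P a b c → P c b a := by
    rintro a b c ⟨h1, h2, h3, h4⟩
    refine ⟨h3.symm, h2.symm, h1.symm, ?_⟩
    refine (hF.apply_threeCycle hfix h3.symm h2.symm h1.symm).resolve_right fun h => ?_
    have := DFunLike.congr_fun (F.injective (h.trans h4.symm)) a
    simp only [threeCycle, Perm.mul_apply, swap_apply_def] at this
    grind
  have repl : ∀ {a b c} d, P a b c → d ≠ a → d ≠ b → P a b d := by
    rintro a b c d ⟨h1, h2, h3, h4⟩ ha hb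
    by_cases hcd : c = d
    · subst hcd; exact ⟨h1, h2, h3, h4⟩
    · exact ⟨h1, ha.symm, hb.symm,
        hF.threeCycle_fixed_of_common_edge hfix h1 h2 ha.symm h3 hb.symm hcd h4⟩
  have h0 : P x y z := ⟨hxy, hxz, hyz, h⟩
  have hA : ∃ y' z', P a y' z' := by
    by_cases h1 : a = x
    · subst h1; exact ⟨_, _, h0⟩
    by_cases h2 : a = y
    · subst h2; exact ⟨_, _, rot h0⟩
    exact ⟨_, _, rot (rot (repl a h0 h1 h2))⟩
  obtain ⟨y', z', hA⟩ := hA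
  have hB : ∃ z', P a b z' := by
    by_cases h1 : b = y'
    · subst h1; exact ⟨_, hA⟩
    exact ⟨_, rot (flip (rot (rot (repl b hA hab.symm h1))))⟩
  obtain ⟨z', hB⟩ := hB
  exact (repl c hB hac.symm hbc.symm).2.2.2

/-- `F` fixes the identity, every transposition and every `3`-cycle. -/
def FixesCycles (F : Perm (Perm α)) : Prop :=
  FixesSwaps F ∧ ∀ a b c, a ≠ b → a ≠ c → b ≠ c → F (threeCycle a b c) = threeCycle a b c

theorem PresSwap.conj_mulLeft {F : Perm (Perm α)} (hF : PresSwap F) (t : Perm α) :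
    PresSwap ((Equiv.mulLeft t)⁻¹ * F * Equiv.mulLeft t) := by
  intro x y
  have e : ∀ x, ((Equiv.mulLeft t)⁻¹ * F * Equiv.mulLeft t) x = t⁻¹ * F (t * x) := fun x => by
    rw [Perm.mul_apply, Perm.mul_apply, Perm.inv_eq_iff_eq]; simp
  rw [e, e, mul_inv_rev, inv_inv, mul_assoc, mul_inv_cancel_left, hF, mul_inv_rev, mul_assoc,
    inv_mul_cancel_left]

/-- This carries the hypotheses from `1` to the adjacent vertex `swap x y`. A product of `swap x y`
with a transposition is `1`, a 3-cycle or a double transposition; the last is fixed as the only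
common neighbour of its two factors besides `1`. -/
theorem PresSwap.fixesCycles_conj {F : Perm (Perm α)} (hF : PresSwap F) (hfix : FixesCycles F)
    {x y z : α} (hxy : x ≠ y) (hxz : x ≠ z) (hyz : y ≠ z) :
    FixesCycles ((Equiv.mulLeft (swap x y))⁻¹ * F * Equiv.mulLeft (swap x y)) := by
  set F' := (Equiv.mulLeft (swap x y))⁻¹ * F * Equiv.mulLeft (swap x y) with hF'
  have e : ∀ w v, F' w = v ↔ F (swap x y * w) = swap x y * v := fun w v => by
    rw [hF', Perm.mul_apply, Perm.mul_apply, Perm.inv_eq_iff_eq]; rfl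
  have hPres : PresSwap F' := hF.conj_mulLeft _
  have hsw : FixesSwaps F' := by
    refine ⟨?_, fun a b hab => ?_⟩
    · rw [e, mul_one, hfix.1.2 x y hxy]
    · rw [e]
      have three : ∀ {p q r s : α}, p ≠ q → r = q → s ≠ q → p ≠ s →
          F (swap p q * swap r s) = swap p q * swap r s := by
        rintro p q r s h1 rfl h2 h3
        exact hfix.2 p r s h1 h3 h2.symm
      by_cases h1 : swap a b = swap x y
      · rw [h1, swap_mul_self]; exact hfix.1.1
      by_cases hya : a = y
      · refine three hxy hya (by rw [← hya]; exact hab.symm) ?_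
        rintro rfl; exact h1 (by rw [hya, swap_comm])
      by_cases hyb : b = y
      · rw [swap_comm a b]
        refine three hxy hyb hya ?_
        rintro rfl; exact h1 (by rw [hyb])
      by_cases hxa : a = x
      · rw [swap_comm x y]
        exact three hxy.symm hxa (by rw [← hxa]; exact hab.symm) (Ne.symm hyb)
      by_cases hxb : b = x
      · rw [swap_comm x y, swap_comm a b]
        exact three hxy.symm hxb hxa (Ne.symm hya)
      have hdis := fun w => eq_of_isSwap_inv_mul_of_disjoint (w := w) hxy (Ne.symm hxa)
        (Ne.symm hxb) (Ne.symm hya) (Ne.symm hyb) hab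
      have hcomm : swap x y * swap a b = swap a b * swap x y := by
        ext p
        simp only [Perm.mul_apply, swap_apply_def]
        grind
      refine (hdis (F (swap x y * swap a b)) ?_ ?_).resolve_left ?_
      · rw [← hfix.1.2 x y hxy, hF]
        apply isSwap_inv_mul_comm
        rw [hfix.1.2 x y hxy, inv_mul_cancel_left]
        exact ⟨a, b, hab, rfl⟩
      · rw [← hfix.1.2 a b hab, hF]
        apply isSwap_inv_mul_comm
        rw [hfix.1.2 a b hab, hcomm, inv_mul_cancel_left]
        exact ⟨x, y, hxy, rfl⟩
      · intro h
        rw [← hfix.1.1] at h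
        have h2 := DFunLike.congr_fun (F.injective h) x
        rw [Perm.mul_apply, swap_apply_of_ne_of_ne (Ne.symm hxa) (Ne.symm hxb),
          swap_apply_left] at h2
        exact hxy h2.symm
  -- A single fixed 3-cycle suffices, and `swap x y * threeCycle x y z = swap y z` provides it.
  refine ⟨hsw, fun a b c hab hac hbc => hPres.threeCycle_fixed hsw hxy hxz hyz ?_ hab hac hbc⟩
  rw [e, threeCycle, ← mul_assoc, swap_mul_self, one_mul]
  exact hfix.1.2 y z hyz

/-- The induction must let `F` vary: `F` fixes `swap x y * g` exactly when its conjugate by that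
left translation fixes `g`. -/
theorem PresSwap.eq_one [Finite α] {F : Perm (Perm α)} (hF : PresSwap F) (hfix : FixesCycles F)
    (h3 : ∀ x y : α, ∃ z, x ≠ z ∧ y ≠ z) : F = 1 := by
  ext1 g
  rw [Perm.one_apply]
  induction g using Perm.swap_induction_on generalizing F with
  | one => exact hfix.1.1
  | swap_mul g x y hxy ih =>
    obtain ⟨z, hxz, hyz⟩ := h3 x y
    have := ih (hF.conj_mulLeft (swap x y)) (hF.fixesCycles_conj hfix hxy hxz hyz)
    rw [Perm.mul_apply, Perm.mul_apply, Perm.inv_eq_iff_eq] at this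
    exact this

end Transpositions

/-! ### Action on transpositions and classification of the Cayley graph automorphisms -/

section Transpositions

variable {α : Type*} [DecidableEq α]

theorem exists_sharing_of_isSwap {u v : Perm α} (hu : u.IsSwap) (hv : v.IsSwap) (huv : u ≠ v)
    (h : ∀ a b c d, a ≠ b → a ≠ c → a ≠ d → b ≠ c → b ≠ d → c ≠ d → u = swap a b → v = swap c d →
      False) :
    ∃ x y z, x ≠ y ∧ x ≠ z ∧ y ≠ z ∧ u = swap x y ∧ v = swap x z := by
  obtain ⟨p, q, hpq, rfl⟩ := hu
  obtain ⟨r, s, hrs, rfl⟩ := hv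
  by_cases h1 : p = r
  · subst h1
    exact ⟨p, q, s, hpq, hrs, fun e => huv (by rw [e]), rfl, rfl⟩
  by_cases h2 : p = s
  · subst h2
    exact ⟨p, q, r, hpq, hrs.symm, fun e => huv (by rw [e, swap_comm]), rfl, swap_comm _ _⟩
  by_cases h3 : q = r
  · subst h3
    exact ⟨q, p, s, hpq.symm, hrs, h2, swap_comm _ _, rfl⟩
  by_cases h4 : q = s
  · subst h4
    exact ⟨q, p, r, hpq.symm, hrs.symm, h1, swap_comm _ _, swap_comm _ _⟩
  exact (h p q r s hpq h1 h2 h3 h4 hrs rfl rfl).elim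

theorem PresSwap.isSwap_apply {F : Perm (Perm α)} (hF : PresSwap F) (h1 : F 1 = 1) {s : Perm α}
    (hs : s.IsSwap) : (F s).IsSwap := by
  have := (hF 1 s).2 (by simpa using hs)
  rwa [h1, inv_one, one_mul] at this

theorem swap_left_inj {a b c : α} (h : swap a b = swap a c) : b = c := by
  simpa using DFunLike.congr_fun h a

theorem PresSwap.isSwap_inv_mul_apply {F : Perm (Perm α)} (hF : PresSwap F) {a b c : α}
    (hab : a ≠ b) (hac : a ≠ c) (hbc : b ≠ c) {s : Perm α} (hs : s.IsSwap)
    (h : s = swap a b ∨ s = swap b c ∨ s = swap a c) :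
    ((F (threeCycle a b c))⁻¹ * F s).IsSwap := by
  rwa [hF, isSwap_threeCycle_inv_mul_iff hab hac hbc hs]

/-- Transpositions with a common point are mapped to transpositions with a common point. -/
theorem PresSwap.exists_sharing {F : Perm (Perm α)} (hF : PresSwap F) (h1 : F 1 = 1) {a b c : α}
    (hab : a ≠ b) (hac : a ≠ c) (hbc : b ≠ c) :
    ∃ x y z, x ≠ y ∧ x ≠ z ∧ y ≠ z ∧ F (swap a b) = swap x y ∧ F (swap a c) = swap x z := by
  apply exists_sharing_of_isSwap
  · exact hF.isSwap_apply h1 ⟨_, _, hab, rfl⟩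
  · exact hF.isSwap_apply h1 ⟨_, _, hac, rfl⟩
  · exact fun h => hbc (swap_left_inj (F.injective h))
  · intro p q r s n1 n2 n3 n4 n5 n6 e1 e2
    -- If the images were disjoint, both 3-cycles adjacent to `swap a b` and `swap a c` would be
    -- sent to the one common neighbour of the images other than `1`, contradicting injectivity.
    have key : ∀ w : Perm α, w ≠ 1 → ((F w)⁻¹ * F (swap a b)).IsSwap →
        ((F w)⁻¹ * F (swap a c)).IsSwap → F w = swap p q * swap r s := by
      intro w hw i1 i2
      rw [e1] at i1
      rw [e2] at i2
      refine (eq_of_isSwap_inv_mul_of_disjoint n1 n2 n3 n4 n5 n6 i1 i2).resolve_left fun h => ?_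
      rw [← h1] at h
      exact hw (F.injective h)
    have k1 := key _ (threeCycle_ne_one hab hac)
      (hF.isSwap_inv_mul_apply hab hac hbc ⟨_, _, hab, rfl⟩ (Or.inl rfl))
      (hF.isSwap_inv_mul_apply hab hac hbc ⟨_, _, hac, rfl⟩ (Or.inr (Or.inr rfl)))
    have k2 := key _ (threeCycle_ne_one hac hab)
      (hF.isSwap_inv_mul_apply hac hab hbc.symm ⟨_, _, hab, rfl⟩ (Or.inr (Or.inr rfl)))
      (hF.isSwap_inv_mul_apply hac hab hbc.symm ⟨_, _, hac, rfl⟩ (Or.inl rfl))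
    have := DFunLike.congr_fun (F.injective (k1.trans k2.symm)) a
    simp only [threeCycle, Perm.mul_apply, swap_apply_def] at this
    grind

/-- A transposition adjacent to a `3`-cycle is mapped into the triangle of the image. -/
theorem PresSwap.isSwap_threeCycle_apply_iff {F : Perm (Perm α)} (hF : PresSwap F) (h1 : F 1 = 1)
    {a b c x y z : α} (hab : a ≠ b) (hac : a ≠ c) (hbc : b ≠ c) (hxy : x ≠ y) (hxz : x ≠ z)
    (hyz : y ≠ z) (e1 : F (swap a b) = swap x y) (e2 : F (swap a c) = swap x z) {s : Perm α}
    (hs : s.IsSwap) :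
    (s = swap a b ∨ s = swap b c ∨ s = swap a c) ↔
      (F s = swap x y ∨ F s = swap y z ∨ F s = swap x z) := by
  rw [← isSwap_threeCycle_inv_mul_iff hab hac hbc hs, ← hF]
  have i1 := hF.isSwap_inv_mul_apply hab hac hbc ⟨_, _, hab, rfl⟩ (Or.inl rfl)
  have i2 := hF.isSwap_inv_mul_apply hab hac hbc ⟨_, _, hac, rfl⟩ (Or.inr (Or.inr rfl))
  rw [e1, swap_comm] at i1
  rw [e2] at i2
  have hFs := hF.isSwap_apply h1 hs
  rcases eq_of_isSwap_inv_mul_of_sharing hxy.symm hyz hxz i1 i2 with h | h | h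
  · rw [← h1] at h
    exact absurd (F.injective h) (threeCycle_ne_one hab hac)
  · rw [h, isSwap_threeCycle_inv_mul_iff hxy.symm hyz hxz hFs, swap_comm y x]
    tauto
  · rw [h, isSwap_threeCycle_inv_mul_iff hxz.symm hyz.symm hxy hFs, swap_comm z x,
      swap_comm z y]
    tauto

/-- An automorphism of the transposition Cayley graph that fixes the identity acts on the
transpositions as a conjugation. -/
theorem PresSwap.exists_apply_swap [Finite α] {F : Perm (Perm α)} (hF : PresSwap F) (h1 : F 1 = 1)
    {o o₁ o₂ : α} (h01 : o ≠ o₁) (h02 : o ≠ o₂) (h12 : o₁ ≠ o₂) :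
    ∃ g : Perm α, ∀ a b, a ≠ b → F (swap a b) = swap (g a) (g b) := by
  obtain ⟨x, y, z, hxy, hxz, hyz, e1, e2⟩ := hF.exists_sharing h1 h01 h02 h12
  have hstar : ∀ j, ∃ w, o ≠ j → x ≠ w ∧ F (swap o j) = swap x w := by
    intro j
    by_cases hj1 : j = o₁
    · exact ⟨y, fun _ => ⟨hxy, by rw [hj1, e1]⟩⟩
    by_cases hj2 : j = o₂
    · exact ⟨z, fun _ => ⟨hxz, by rw [hj2, e2]⟩⟩
    by_cases hj : o = j
    · exact ⟨x, fun h => absurd hj h⟩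
    -- A transposition that overlaps both `swap x y` and `swap x z` but avoids `x` is `swap y z`.
    -- That one lies in the image of the triangle on `o`, `o₁`, `o₂`, to which `swap o j` does not
    -- belong.
    have hnot := (hF.isSwap_threeCycle_apply_iff h1 h01 h02 h12 hxy hxz hyz e1 e2
      ⟨o, j, hj, rfl⟩).not.1 (by
        rintro (h | h | h)
        · exact hj1 (swap_left_inj h)
        · have := DFunLike.congr_fun h o
          rw [swap_apply_left, swap_apply_of_ne_of_ne h01 h02] at this
          exact hj this.symm
        · exact hj2 (swap_left_inj h))
    push Not at hnot
    obtain ⟨p, q, r, hpq, hpr, hqr, f1, f2⟩ := hF.exists_sharing h1 h01 hj (Ne.symm hj1)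
    obtain ⟨p', q', r', hpq', hpr', hqr', f1', f2'⟩ := hF.exists_sharing h1 h02 hj (Ne.symm hj2)
    rw [e1] at f1
    rw [e2] at f1'
    have mem : ∀ {a b c d : α}, a ≠ b → swap a b = swap c d → c = a ∨ c = b := by
      intro a b c d hab h
      by_contra! hc
      have h3 := DFunLike.congr_fun h c
      rw [swap_apply_of_ne_of_ne hc.1 hc.2, swap_apply_left] at h3
      rw [← h3, swap_self] at h
      exact hab (by simpa using (DFunLike.congr_fun h a).symm)
    -- if the image avoids `x`, it is `swap y z`
    by_cases hp : p = x
    · exact ⟨r, fun _ => ⟨by rw [← hp]; exact hpr, by rw [f2, hp]⟩⟩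
    have hpy : p = y := (mem hxy f1).resolve_left hp
    by_cases hp' : p' = x
    · exact ⟨r', fun _ => ⟨by rw [← hp']; exact hpr', by rw [f2', hp']⟩⟩
    have hpz : p' = z := (mem hxz f1').resolve_left hp'
    rw [hpy] at f2
    rw [hpz] at f2'
    rcases mem hpr' (hpz ▸ f2'.symm.trans f2) with h | h
    · exact absurd (h.trans hpz) hyz
    · rw [← h, swap_comm z] at f2'
      exact absurd f2' hnot.2.1
  choose γ' hγ' using hstar
  let γ : α → α := fun j => if j = o then x else γ' j
  have hγo : γ o = x := if_pos rfl
  have hγ : ∀ j, o ≠ j → x ≠ γ j ∧ F (swap o j) = swap x (γ j) := by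
    intro j hj
    have : γ j = γ' j := if_neg (Ne.symm hj)
    rw [this]
    exact hγ' j hj
  have hinj : Function.Injective γ := by
    intro i j hij
    by_cases hi : o = i
    · by_cases hj : o = j
      · rw [← hi, ← hj]
      · rw [← hi, hγo] at hij
        exact absurd hij (hγ j hj).1
    · by_cases hj : o = j
      · rw [← hj, hγo] at hij
        exact absurd hij.symm (hγ i hi).1
      · have := (hγ i hi).2
        rw [hij, ← (hγ j hj).2] at this
        exact swap_left_inj (F.injective this)
  refine ⟨Equiv.ofBijective γ (Finite.injective_iff_bijective.1 hinj), fun a b hab => ?_⟩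
  simp only [Equiv.ofBijective_apply]
  by_cases ha : o = a
  · rw [← ha, hγo]
    exact (hγ b (by rwa [ha])).2
  by_cases hb : o = b
  · rw [← hb, hγo, swap_comm, swap_comm (γ a)]
    exact (hγ a ha).2
  have hgab := hinj.ne hab
  -- `swap a b` is the third edge of the triangle on `o`, `a`, `b`, so its image is the third edge
  -- of the image triangle; the other two are already taken.
  rcases (hF.isSwap_threeCycle_apply_iff h1 ha hb hab (hγ a ha).1 (hγ b hb).1 hgab (hγ a ha).2
    (hγ b hb).2 ⟨a, b, hab, rfl⟩).1 (Or.inr (Or.inl rfl)) with h | h | h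
  · rw [← (hγ a ha).2] at h
    have := DFunLike.congr_fun (F.injective h) o
    rw [swap_apply_left, swap_apply_of_ne_of_ne ha hb] at this
    exact absurd this ha
  · exact h
  · rw [← (hγ b hb).2] at h
    have := DFunLike.congr_fun (F.injective h) o
    rw [swap_apply_left, swap_apply_of_ne_of_ne ha hb] at this
    exact absurd this hb

theorem PresSwap.mul {F G : Perm (Perm α)} (hF : PresSwap F) (hG : PresSwap G) :
    PresSwap (F * G) := fun x y => (hF _ _).trans (hG x y)

theorem presSwap_mulLeft (g : Perm α) : PresSwap (Equiv.mulLeft g) := fun x y => by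
  simp

theorem isSwap_conj_iff {g z : Perm α} : (g * z * g⁻¹).IsSwap ↔ z.IsSwap := by
  have key : ∀ (g z : Perm α), z.IsSwap → (g * z * g⁻¹).IsSwap := by
    rintro g z ⟨a, b, hab, rfl⟩
    exact ⟨g a, g b, g.injective.ne hab, by rw [mul_swap_eq_swap_mul, mul_inv_cancel_right]⟩
  refine ⟨fun h => ?_, key g z⟩
  simpa [mul_assoc] using key g⁻¹ _ h

theorem presSwap_mulRight (g : Perm α) : PresSwap (Equiv.mulRight g) := fun x y => by
  have := isSwap_conj_iff (g := g⁻¹) (z := x⁻¹ * y)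
  simpa [mul_assoc] using this

theorem presSwap_inv : PresSwap (Equiv.inv (Perm α)) := fun x y => by
  change (x⁻¹⁻¹ * y⁻¹).IsSwap ↔ _
  rw [inv_inv, ← isSwap_conj_iff (g := x⁻¹)]
  have : x⁻¹ * (x * y⁻¹) * x⁻¹⁻¹ = (x⁻¹ * y)⁻¹ := by simp
  rw [this]
  exact ⟨fun h => by simpa using isSwap_inv h, isSwap_inv⟩

/-- The automorphisms of the transposition Cayley graph on at least three points. -/
theorem PresSwap.exists_eq [Finite α] {F : Perm (Perm α)} (hF : PresSwap F) {o o₁ o₂ : α}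
    (h01 : o ≠ o₁) (h02 : o ≠ o₂) (h12 : o₁ ≠ o₂) :
    ∃ g q : Perm α, (∀ x, F x = g * x * q) ∨ ∀ x, F x = g * x⁻¹ * q := by
  have h3 : ∀ x y : α, ∃ z, x ≠ z ∧ y ≠ z := by
    intro x y
    by_contra! h
    have e0 := h o; have e1 := h o₁; have e2 := h o₂
    by_cases x = o <;> by_cases x = o₁ <;> by_cases x = o₂ <;> grind
  let F₁ := Equiv.mulLeft (F 1)⁻¹ * F
  have hF₁ : PresSwap F₁ := (presSwap_mulLeft _).mul hF
  have hF₁1 : F₁ 1 = 1 := inv_mul_cancel (F 1)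
  obtain ⟨g, hg⟩ := hF₁.exists_apply_swap hF₁1 h01 h02 h12
  let F₂ := Equiv.mulLeft g⁻¹ * Equiv.mulRight g * F₁
  have hF₂ : PresSwap F₂ := ((presSwap_mulLeft _).mul (presSwap_mulRight _)).mul hF₁
  have e₂ : ∀ x, F₂ x = g⁻¹ * ((F 1)⁻¹ * F x * g) := fun _ => rfl
  have hfix : FixesSwaps F₂ := by
    refine ⟨?_, fun a b hab => ?_⟩
    · change g⁻¹ * (F₁ 1 * g) = 1
      rw [hF₁1]; simp
    · change g⁻¹ * (F₁ (swap a b) * g) = swap a b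
      rw [hg a b hab, ← mul_swap_eq_swap_mul, inv_mul_cancel_left]
  rcases hF₂.apply_threeCycle hfix h01 h02 h12 with h | h
  · have := hF₂.eq_one ⟨hfix, fun a b c => hF₂.threeCycle_fixed hfix h01 h02 h12 h⟩ h3
    refine ⟨F 1 * g, g⁻¹, Or.inl fun x => ?_⟩
    have e := e₂ x
    rw [this, Perm.one_apply] at e
    nth_rw 2 [e]
    simp [mul_assoc]
  · let F₃ := Equiv.inv (Perm α) * F₂
    have hF₃ : PresSwap F₃ := presSwap_inv.mul hF₂
    have hfix₃ : FixesSwaps F₃ := by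
      refine ⟨?_, fun a b hab => ?_⟩
      · change (F₂ 1)⁻¹ = 1
        rw [hfix.1, inv_one]
      · change (F₂ (swap a b))⁻¹ = swap a b
        rw [hfix.2 a b hab, swap_inv]
    have h' : F₃ (threeCycle o o₁ o₂) = threeCycle o o₁ o₂ := by
      change (F₂ _)⁻¹ = _
      rw [h, threeCycle_inv]
    have := hF₃.eq_one ⟨hfix₃, fun a b c => hF₃.threeCycle_fixed hfix₃ h01 h02 h12 h'⟩ h3
    refine ⟨F 1 * g, g⁻¹, Or.inr fun x => ?_⟩
    have e : F₃ x = (F₂ x)⁻¹ := rfl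
    rw [this, Perm.one_apply, e₂] at e
    nth_rw 2 [e]
    simp [mul_assoc]

end Transpositions

/-! ### The subgroups `P`, `Q`, `⟨h⟩` inside the automorphism group, and conclusion -/

theorem adj_self_iff {n k : ℕ} (hk : 1 ≤ k) (s t : Tuples n k) :
    (arrangementGraph n k k).Adj s t ↔ ∀ i, s i ≠ t i := by
  have h : (Finset.univ.filter fun i : Fin k => s i ≠ t i).card = k ↔ ∀ i, s i ≠ t i := by
    conv_lhs => rhs; rw [← Finset.card_fin k]
    rw [Finset.card_filter_eq_iff]
    simp
  refine ⟨fun h' => h.1 h'.2, fun h' => ⟨?_, h.2 h'⟩⟩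
  rintro rfl
  exact h' ⟨0, hk⟩ rfl

theorem adj_symbolPerm {n k r : ℕ} (g : Perm (Fin n)) (s t : Tuples n k) :
    (arrangementGraph n k r).Adj (symbolPerm n k g s) (symbolPerm n k g t) ↔
      (arrangementGraph n k r).Adj s t := by
  simp [arrangementGraph]

theorem adj_coordPerm {n k r : ℕ} (q : Perm (Fin k)) (s t : Tuples n k) :
    (arrangementGraph n k r).Adj (coordPerm n k q s) (coordPerm n k q t) ↔
      (arrangementGraph n k r).Adj s t := by
  refine and_congr (by simp) ?_
  have : (Finset.univ.filter fun i : Fin k => coordPerm n k q s i ≠ coordPerm n k q t i).card =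
      (Finset.univ.filter fun i : Fin k => s i ≠ t i).card := by
    symm
    refine Finset.card_equiv q fun i => ?_
    simp
  rw [this]

/-- The homomorphism `(P g, Q q) ↦ P g * Q q`. -/
def productHom (n k : ℕ) :
    ((symbolPerm n k).range × (coordPerm n k).range) →* Perm (Tuples n k) :=
  MonoidHom.noncommCoprod (symbolPerm n k).range.subtype (coordPerm n k).range.subtype (by
    rintro ⟨_, g, rfl⟩ ⟨_, q, rfl⟩
    exact commute_symbolPerm_coordPerm g q)

theorem productHom_apply {n k : ℕ} (x : (symbolPerm n k).range × (coordPerm n k).range) :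
    productHom n k x = (x.1 : Perm (Tuples n k)) * (x.2 : Perm (Tuples n k)) := rfl

theorem exists_ne_ne {n : ℕ} (hn : 2 < n) (a b : Fin n) : ∃ c, c ≠ a ∧ c ≠ b := by
  obtain ⟨c, hc⟩ := Finset.exists_mem_notMem_of_card_lt_card
    (s := {a, b}) (t := (Finset.univ : Finset (Fin n)))
    (by rw [Finset.card_univ, Fintype.card_fin]; exact Finset.card_le_two.trans_lt hn)
  exact ⟨c, by simpa using hc⟩

/-- For `n > 2`, a coordinate permutation that is also a symbol permutation is trivial. -/
theorem symbolPerm_eq_one_of_mul_coordPerm {n k : ℕ} (hn : 2 < n) (hk : 1 ≤ k) (hkn : k ≤ n)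
    {g : Perm (Fin n)} {q : Perm (Fin k)} (h : symbolPerm n k g * coordPerm n k q = 1) :
    symbolPerm n k g = 1 := by
  have h1 : ∀ (s : Tuples n k) i, g (s i) = s (q i) := fun s i => by
    have := DFunLike.congr_fun (DFunLike.congr_fun h s) (q i)
    simpa using this
  have hg : g = 1 := by
    ext1 a
    by_contra hga
    rw [Perm.one_apply] at hga
    obtain ⟨s₀⟩ : Nonempty (Tuples n k) := ⟨Fin.castLEEmb hkn⟩
    let i : Fin k := ⟨0, hk⟩
    obtain ⟨s, hs⟩ : ∃ s : Tuples n k, s i = a :=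
      ⟨symbolPerm n k (swap (s₀ i) a) s₀, by simp⟩
    -- A third symbol `c` exists because `2 < n`. Exchanging `g a` with `c` keeps the entry `a` at
    -- `i` but changes the entry at `q i`, which `g` and `a` alone should determine.
    obtain ⟨c, hc, hc'⟩ := exists_ne_ne hn a (g a)
    have h2 := h1 s i
    have h3 := h1 (symbolPerm n k (swap (g a) c) s) i
    rw [hs] at h2
    rw [symbolPerm_apply, symbolPerm_apply, ← h2, hs,
      swap_apply_of_ne_of_ne (Ne.symm hga) hc.symm, swap_apply_left] at h3
    exact hc' h3.symm
  rw [hg, map_one]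

theorem productHom_injective {n k : ℕ} (hn : 2 < n) (hk : 1 ≤ k) (hkn : k ≤ n) :
    Function.Injective (productHom n k) := by
  rw [injective_iff_map_eq_one]
  rintro ⟨⟨_, g, rfl⟩, ⟨_, q, rfl⟩⟩ h
  rw [productHom_apply] at h
  have h1 := symbolPerm_eq_one_of_mul_coordPerm hn hk hkn h
  simp only [h1, one_mul] at h
  exact Prod.ext (Subtype.ext h1) (Subtype.ext h)

theorem adj_productHom {n k r : ℕ} (x : (symbolPerm n k).range × (coordPerm n k).range)
    (s t : Tuples n k) :
    (arrangementGraph n k r).Adj (productHom n k x s) (productHom n k x t) ↔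
      (arrangementGraph n k r).Adj s t := by
  obtain ⟨⟨_, g, rfl⟩, ⟨_, q, rfl⟩⟩ := x
  exact (adj_symbolPerm g _ _).trans (adj_coordPerm q s t)

/-- Reading an `n`-tuple of distinct elements of `[n]` as a permutation. -/
noncomputable def tuplePerm (n : ℕ) : Tuples n n ≃ Perm (Fin n) := Equiv.embeddingEquivOfFinite _

theorem tuplePerm_apply {n : ℕ} (s : Tuples n n) (i : Fin n) : tuplePerm n s i = s i := rfl

theorem tuplePerm_symbolPerm {n : ℕ} (g : Perm (Fin n)) (s : Tuples n n) :
    tuplePerm n (symbolPerm n n g s) = g * tuplePerm n s := by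
  ext i; rfl

theorem tuplePerm_coordPerm {n : ℕ} (q : Perm (Fin n)) (s : Tuples n n) :
    tuplePerm n (coordPerm n n q s) = tuplePerm n s * q⁻¹ := by
  ext i; rfl

theorem tuplePerm_inversionPerm {n : ℕ} (s : Tuples n n) :
    tuplePerm n (inversionPerm n s) = (tuplePerm n s)⁻¹ := by
  ext1 i
  rw [tuplePerm_apply, inversionPerm_apply_eq_iff]
  exact (tuplePerm n s).apply_symm_apply i

theorem inversionPerm_conj_symbolPerm {n : ℕ} (g : Perm (Fin n)) :
    inversionPerm n * symbolPerm n n g * (inversionPerm n)⁻¹ = coordPerm n n g := by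
  rw [mul_inv_eq_iff_eq_mul]
  ext1 s
  apply (tuplePerm n).injective
  simp only [Perm.mul_apply, tuplePerm_inversionPerm, tuplePerm_symbolPerm, tuplePerm_coordPerm,
    mul_inv_rev]

theorem inversionPerm_mul_self (n : ℕ) : inversionPerm n * inversionPerm n = 1 := by
  ext1 s
  apply (tuplePerm n).injective
  simp [tuplePerm_inversionPerm]

theorem inversionPerm_inv (n : ℕ) : (inversionPerm n)⁻¹ = inversionPerm n :=
  inv_eq_of_mul_eq_one_left (inversionPerm_mul_self n)

theorem inversionPerm_conj_coordPerm {n : ℕ} (g : Perm (Fin n)) :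
    inversionPerm n * coordPerm n n g * (inversionPerm n)⁻¹ = symbolPerm n n g := by
  rw [← inversionPerm_conj_symbolPerm, inversionPerm_inv]
  simp [mul_assoc, inversionPerm_mul_self, ← mul_assoc (inversionPerm n) (inversionPerm n)]

theorem range_productHom {n k : ℕ} {f : Perm (Tuples n k)} :
    f ∈ (productHom n k).range ↔ ∃ g q, symbolPerm n k g * coordPerm n k q = f := by
  constructor
  · rintro ⟨⟨⟨_, g, rfl⟩, ⟨_, q, rfl⟩⟩, rfl⟩
    exact ⟨g, q, rfl⟩
  · rintro ⟨g, q, rfl⟩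
    exact ⟨⟨⟨_, g, rfl⟩, ⟨_, q, rfl⟩⟩, rfl⟩

/-- Conjugation by the inversion exchanges left and right multiplication, that is, `P g` and `Q g`.
-/
theorem inversionPerm_mem_normalizer (n : ℕ) :
    inversionPerm n ∈ Subgroup.normalizer ((productHom n n).range : Set (Perm (Tuples n n))) := by
  have key : ∀ f ∈ (productHom n n).range,
      inversionPerm n * f * (inversionPerm n)⁻¹ ∈ (productHom n n).range := by
    intro f hf
    obtain ⟨g, q, rfl⟩ := range_productHom.1 hf
    rw [← conj_mul, inversionPerm_conj_symbolPerm, inversionPerm_conj_coordPerm,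
      ← (commute_symbolPerm_coordPerm q g).eq]
    exact range_productHom.2 ⟨_, _, rfl⟩
  rw [Subgroup.mem_normalizer_iff]
  intro f
  refine ⟨key f, fun h => ?_⟩
  have := key _ h
  rw [inversionPerm_inv] at this
  simpa [mul_assoc, inversionPerm_mul_self, ← mul_assoc (inversionPerm n) (inversionPerm n)]
    using this

/-- If `x⁻¹ = g * x * q⁻¹` for all `x`, then `x = 1` gives `q = g`. Inversion would then be a
conjugation, hence multiplicative, and the symmetric group on more than two points would be abelian.
-/
theorem inversionPerm_notMem_range {n : ℕ} (hn : 2 < n) :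
    inversionPerm n ∉ (productHom n n).range := by
  rw [range_productHom]
  rintro ⟨g, q, h⟩
  have h1 : ∀ x : Perm (Fin n), g * (x * q⁻¹) = x⁻¹ := by
    intro x
    obtain ⟨s, rfl⟩ := (tuplePerm n).surjective x
    rw [← tuplePerm_inversionPerm, ← h, Perm.mul_apply, tuplePerm_symbolPerm, tuplePerm_coordPerm]
  have hq : q⁻¹ = g⁻¹ := by
    have := h1 1
    rw [one_mul, inv_one] at this
    exact eq_inv_of_mul_eq_one_right this
  have hcomm : ∀ x y : Perm (Fin n), x * y = y * x := by
    intro x y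
    have h2 : ∀ x, x⁻¹ = g * x * g⁻¹ := fun x => by rw [← h1 x, hq, mul_assoc]
    apply inv_injective
    rw [h2 (x * y), ← conj_mul, ← h2, ← h2, mul_inv_rev]
  let a : Fin n := ⟨0, by omega⟩
  let b : Fin n := ⟨1, by omega⟩
  let c : Fin n := ⟨2, hn⟩
  have := DFunLike.congr_fun (hcomm (swap a b) (swap a c)) a
  have hab : a ≠ b := by simp [a, b]
  have hac : a ≠ c := by simp [a, c]
  have hbc : b ≠ c := by simp [b, c]
  rw [Perm.mul_apply, Perm.mul_apply, swap_apply_left, swap_apply_left,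
    swap_apply_of_ne_of_ne hac.symm hbc.symm, swap_apply_of_ne_of_ne hab.symm hbc] at this
  exact hbc this.symm

theorem orderOf_inversionPerm {n : ℕ} (hn : 2 < n) : orderOf (inversionPerm n) = 2 := by
  rw [orderOf_eq_prime_iff]
  refine ⟨by rw [pow_two, inversionPerm_mul_self], fun h => inversionPerm_notMem_range hn ?_⟩
  rw [h]
  exact one_mem _

theorem mem_zpowers_inversionPerm {n : ℕ} {f : Perm (Tuples n n)} :
    f ∈ Subgroup.zpowers (inversionPerm n) ↔ f = 1 ∨ f = inversionPerm n := by
  constructor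
  · rintro ⟨m, rfl⟩
    rcases Int.even_or_odd' m with ⟨p, rfl | rfl⟩
    · left
      simp [zpow_mul, zpow_ofNat, pow_two, inversionPerm_mul_self]
    · right
      simp [zpow_add, zpow_mul, zpow_ofNat, pow_two, inversionPerm_mul_self]
  · rintro (rfl | rfl)
    · exact one_mem _
    · exact Subgroup.mem_zpowers _

theorem disjoint_range_zpowers {n : ℕ} (hn : 2 < n) :
    Disjoint (productHom n n).range (Subgroup.zpowers (inversionPerm n)) := by
  rw [Subgroup.disjoint_def]
  intro f hf hf'
  rcases mem_zpowers_inversionPerm.1 hf' with h | rfl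
  · exact h
  · exact absurd hf (inversionPerm_notMem_range hn)

theorem adj_inversionPerm {n r : ℕ} (s t : Tuples n n) :
    (arrangementGraph n n r).Adj (inversionPerm n s) (inversionPerm n t) ↔
      (arrangementGraph n n r).Adj s t := by
  refine and_congr (by simp) ?_
  have : (Finset.univ.filter fun i => inversionPerm n s i ≠ inversionPerm n t i).card =
      (Finset.univ.filter fun i => s i ≠ t i).card := by
    symm
    -- The inverses of `s` and `t` agree at the symbol `s i` exactly when `s` and `t` agree at `i`.
    refine Finset.card_equiv (tuplePerm n s) fun i => ?_
    simp only [Finset.mem_filter, Finset.mem_univ, true_and, tuplePerm_apply, ne_eq]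
    rw [(inversionPerm_apply_eq_iff s i (s i)).2 rfl, eq_comm (a := i), inversionPerm_apply_eq_iff,
      eq_comm]
  rw [this]

theorem adj_two_iff {n : ℕ} (s t : Tuples n n) :
    (arrangementGraph n n 2).Adj s t ↔ ((tuplePerm n s)⁻¹ * tuplePerm n t).IsSwap := by
  rw [← Perm.card_support_eq_two]
  have : (Finset.univ.filter fun i => s i ≠ t i) =
      ((tuplePerm n s)⁻¹ * tuplePerm n t).support := by
    ext i
    rw [Perm.mem_support, Perm.mul_apply, ne_eq, Perm.inv_eq_iff_eq]
    simp [tuplePerm_apply, eq_comm]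
  change _ ∧ _ ↔ _
  rw [this]
  refine and_iff_right_of_imp ?_
  rintro h rfl
  simp at h

theorem presSwap_of_adj {n r : ℕ} (hn : 2 < n) (hr : r = n ∨ r = 2)
    (f : arrangementGraph n n r ≃g arrangementGraph n n r) :
    PresSwap ((tuplePerm n).permCongr f.toEquiv) := by
  have hadj : ∀ s t, (arrangementGraph n n r).Adj (f s) (f t) ↔
    (arrangementGraph n n r).Adj s t := fun s t => f.map_adj_iff
  rcases hr with rfl | rfl
  · have hd : ∀ x y : Perm (Fin r), (∀ i, (tuplePerm r).permCongr f.toEquiv x i ≠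
        (tuplePerm r).permCongr f.toEquiv y i) ↔ ∀ i, x i ≠ y i := by
      intro x y
      obtain ⟨s, rfl⟩ := (tuplePerm r).surjective x
      obtain ⟨t, rfl⟩ := (tuplePerm r).surjective y
      have := hadj s t
      rw [adj_self_iff (by omega), adj_self_iff (by omega)] at this
      simpa [tuplePerm_apply] using this
    intro x y
    refine ⟨fun h => ?_, isSwap_of_disagree hn hd⟩
    have := isSwap_of_disagree hn (F := ((tuplePerm r).permCongr f.toEquiv).symm)
      (fun x y => by rw [← hd, apply_symm_apply, apply_symm_apply]) h
    rwa [symm_apply_apply, symm_apply_apply] at this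
  · intro x y
    obtain ⟨s, rfl⟩ := (tuplePerm n).surjective x
    obtain ⟨t, rfl⟩ := (tuplePerm n).surjective y
    have := hadj s t
    rw [adj_two_iff, adj_two_iff] at this
    simpa using this

theorem exists_eq_of_graphAut {n r : ℕ} (hn : 2 < n) (hr : r = n ∨ r = 2)
    (f : arrangementGraph n n r ≃g arrangementGraph n n r) :
    ∃ g q, f.toEquiv = symbolPerm n n g * coordPerm n n q ∨
      f.toEquiv = symbolPerm n n g * coordPerm n n q * inversionPerm n := by
  let a : Fin n := ⟨0, by omega⟩
  let b : Fin n := ⟨1, by omega⟩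
  let c : Fin n := ⟨2, hn⟩
  obtain ⟨g, q, h⟩ := (presSwap_of_adj hn hr f).exists_eq (o := a) (o₁ := b) (o₂ := c)
    (by simp [a, b]) (by simp [a, c]) (by simp [b, c])
  refine ⟨g, q⁻¹, h.imp (fun h => ?_) (fun h => ?_)⟩ <;>
  · ext1 s
    apply (tuplePerm n).injective
    have := h (tuplePerm n s)
    rw [permCongr_apply, symm_apply_apply] at this
    rw [this]
    simp only [Perm.mul_apply, tuplePerm_symbolPerm, tuplePerm_coordPerm, tuplePerm_inversionPerm,
      inv_inv, mul_assoc]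

theorem theorem1p1 (n : ℕ) (hn : 2 < n) :
    -- `r = k < n`: the internal direct product `P(S_n) × Q(S_k)`
    (∀ k : ℕ, 1 ≤ k → k < n →
      ∃ e : ((symbolPerm n k).range × (coordPerm n k).range) ≃*
          (arrangementGraph n k k ≃g arrangementGraph n k k),
        ∀ x, (e x).toEquiv = (x.1 : Equiv.Perm (Tuples n k)) * (x.2 : Equiv.Perm (Tuples n k))) ∧
    -- `r = k = n` or `r = 2`, `k = n`: the internal semidirect product
    -- `[P(S_n) × Q(S_n)] ⋊ ⟨h⟩`, with `h` the inversion, of order `2`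
    (∀ r : ℕ, r = n ∨ r = 2 →
      orderOf (inversionPerm n) = 2 ∧
      ∃ (φ : Subgroup.zpowers (inversionPerm n) →*
            MulAut ((symbolPerm n n).range × (coordPerm n n).range))
        (e : (((symbolPerm n n).range × (coordPerm n n).range) ⋊[φ]
              Subgroup.zpowers (inversionPerm n)) ≃*
            (arrangementGraph n n r ≃g arrangementGraph n n r)),
        ∀ x, (e x).toEquiv =
          (x.left.1 : Equiv.Perm (Tuples n n)) * (x.left.2 : Equiv.Perm (Tuples n n)) *
            (x.right : Equiv.Perm (Tuples n n))) := by
  refine ⟨fun k hk hkn => ?_, fun r hr => ⟨orderOf_inversionPerm hn, ?_⟩⟩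
  · refine exists_mulEquiv_graphAut _ (productHom n k) (productHom_injective hn hk hkn.le)
      adj_productHom fun f => ?_
    obtain ⟨g, q, h⟩ := exists_eq_of_disagree hk hkn (f := f.toEquiv) (fun s t => by
      rw [← adj_self_iff hk, ← adj_self_iff hk]
      exact f.map_adj_iff)
    exact range_productHom.2 ⟨g, q, h.symm⟩
  · obtain ⟨φ, F, hinj, hF⟩ := exists_semidirect_hom (productHom n n)
      (productHom_injective hn (by omega) le_rfl) (inversionPerm n)
      (inversionPerm_mem_normalizer n) (disjoint_range_zpowers hn)
    obtain ⟨e, he⟩ := exists_mulEquiv_graphAut (arrangementGraph n n r) F hinj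
      (by
        intro x s t
        rw [hF, Perm.mul_apply, Perm.mul_apply, adj_productHom]
        rcases mem_zpowers_inversionPerm.1 x.right.2 with h | h
        · rw [h]; rfl
        · rw [h]; exact adj_inversionPerm s t)
      (by
        intro f
        obtain ⟨g, q, h⟩ := exists_eq_of_graphAut hn hr f
        obtain ⟨y, hy⟩ := range_productHom.2 ⟨g, q, rfl⟩
        rcases h with h | h
        · exact ⟨⟨y, 1⟩, by rw [hF, hy, h]; exact mul_one _⟩
        · exact ⟨⟨y, ⟨_, Subgroup.mem_zpowers _⟩⟩, by rw [hF, hy, h]⟩)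
    exact ⟨φ, e, fun x => by rw [he, hF, productHom_apply]⟩
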